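/- Let $N\ge 2$, $p>1$ and $\beta\in\mathbb R$, and put $\beta_0=\frac{N-p}{p-1}$. There is a constant $c>0$, depending only on $p$, $N$ and $\beta$, with the following property. Let $S$ be a domain (non-empty connected open subset) of the unit sphere $S^{N-1}$ of $\mathbb R^N$, let $\nabla'$ and $\operatorname{div}'$ be the covariant gradient and the divergence on $S^{N-1}$ for the metric induced by $\mathbb R^N$, let $dS$ be the surface measure, and let $W_0^{1,p}(S)$ be the closure of $C_c^\infty(S)$ in $W^{1,p}(S)$. Let $\omega\in W_0^{1,p}(S)$ be a weak solution of $$-\operatorname{div}'\Big(\big(\beta^2\omega^2+|\nabla'\omega|^2\big)^{\frac{p-2}2}\nabla'\omega\Big)=(p-1)\beta(\beta-\beta_0)\big(\beta^2\omega^2+|\nabla'\omega|^2\big)^{\frac{p-2}2}\omega\quad\text{in }S,\qquad \omega=0\ \text{ on }\partial S,$$ that is, for all $\phi\in C_c^\infty(S)$, $$\int_S\big(\beta^2\omega^2+|\nabla'\omega|^2\big)^{\frac{p-2}2}\langle\nabla'\omega,\nabla'\phi\rangle\,dS=(p-1)\beta(\beta-\beta_0)\int_S\big(\beta^2\omega^2+|\nabla'\omega|^2\big)^{\frac{p-2}2}\omega\,\phi\,dS,$$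 where the fields $(\beta^2\omega^2+|\nabla'\omega|^2)^{\frac{p-2}2}\nabla'\omega$ and $(\beta^2\omega^2+|\nabla'\omega|^2)^{\frac{p-2}2}\omega$ are taken to be $0$ where $\omega$ and $\nabla'\omega$ both vanish. Then: - if $p>N-1$, then, after modification on a null set, $\omega$ satisfies $\|\omega\|_{C^\gamma(S)}\le c\,\|\omega\|_{L^p(S)}$ with $\gamma=1-\frac{N-1}p$, where $\|u\|_{C^\gamma(S)}=\sup_{S}|u|+\sup_{x,y\in S,\,x\ne y}\frac{|u(x)-u(y)|}{|x-y|^\gamma}$; - if $1<p\le N-1$, then $\|\omega\|_{L^\infty(S)}\le c\,\|\omega\|_{L^p(S)}$. -/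

import Mathlib

open MeasureTheory Metric Filter Topology
open scoped ENNReal NNReal

/-- The unit sphere `S^{N-1}` of `ℝ^N` (with the metric, topology and Borel structure induced
by `ℝ^N`). -/
abbrev USphere (N : ℕ) : Type :=
  sphere (0 : EuclideanSpace ℝ (Fin N)) 1

/-- The surface measure `dS` on `S^{N-1}`. -/
noncomputable def surfaceMeasure (N : ℕ) : Measure (USphere N) :=
  (volume : Measure (EuclideanSpace ℝ (Fin N))).toSphere

/-- The radial projection `x ↦ x / |x|` of `ℝ^N ∖ {0}` onto the unit sphere. -/
noncomputable def radialProj {N : ℕ} (x : EuclideanSpace ℝ (Fin N)) (hx : x ≠ 0) : USphere N :=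
  ⟨‖x‖⁻¹ • x, by
    rw [mem_sphere_zero_iff_norm, norm_smul, norm_inv, norm_norm,
      inv_mul_cancel₀ (norm_ne_zero_iff.mpr hx)]⟩

open Classical in
/-- The extension of a function on the sphere to `ℝ^N ∖ {0}` that is constant along rays,
`x ↦ φ (x / |x|)` (with the irrelevant value `0` at the origin). -/
noncomputable def radialExt {N : ℕ} (φ : USphere N → ℝ) (x : EuclideanSpace ℝ (Fin N)) : ℝ :=
  if hx : x ≠ 0 then φ (radialProj x hx) else 0

/-- Smoothness (`C^∞`) of a function on the sphere: its extension constant along rays is smooth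
away from the origin. -/
def SphereSmooth {N : ℕ} (φ : USphere N → ℝ) : Prop :=
  ContDiffOn ℝ (⊤ : ℕ∞) (radialExt φ) {0}ᶜ

/-- The covariant gradient `∇'φ` on the sphere with the metric induced from `ℝ^N`, as a vector of
`ℝ^N` tangent to the sphere. As the extension of `φ` is constant along rays, its Euclidean gradient
at a point `σ` of the sphere has no radial component and its tangential part is `∇'φ σ`. -/
noncomputable def sphereGrad {N : ℕ} (φ : USphere N → ℝ) (σ : USphere N) :
    EuclideanSpace ℝ (Fin N) :=
  gradient (radialExt φ) (σ : EuclideanSpace ℝ (Fin N))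

/-- The test functions `C_c^∞(S)`: smooth functions on the sphere whose (automatically compact)
support lies in `S`. -/
def IsTestFunction {N : ℕ} (S : Set (USphere N)) (φ : USphere N → ℝ) : Prop :=
  SphereSmooth φ ∧ tsupport φ ⊆ S

/-- `ω` belongs to `W_0^{1,p}(S)`, the closure of `C_c^∞(S)` for the norm of `W^{1,p}(S)`, and `G`
is its gradient `∇'ω`: `ω` and `G` are the limits in `L^p(S)` of `φ_n` and `∇'φ_n` for some
sequence of test functions `φ_n`. (The operator `∇'` being closable in `L^p`, the field `G` is
determined by `ω` up to a null set; it is the weak gradient of `ω`.) -/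
structure HasW0Gradient {N : ℕ} (p : ℝ) (S : Set (USphere N)) (ω : USphere N → ℝ)
    (G : USphere N → EuclideanSpace ℝ (Fin N)) : Prop where
  memLp : MemLp ω (ENNReal.ofReal p) ((surfaceMeasure N).restrict S)
  memLp_grad : MemLp G (ENNReal.ofReal p) ((surfaceMeasure N).restrict S)
  approx : ∃ φ : ℕ → USphere N → ℝ, (∀ n, IsTestFunction S (φ n)) ∧
    Tendsto (fun n => eLpNorm (fun σ => φ n σ - ω σ) (ENNReal.ofReal p)
      ((surfaceMeasure N).restrict S)) atTop (𝓝 0) ∧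
    Tendsto (fun n => eLpNorm (fun σ => sphereGrad (φ n) σ - G σ) (ENNReal.ofReal p)
      ((surfaceMeasure N).restrict S)) atTop (𝓝 0)

/-- The exponent `β₀ = (N - p) / (p - 1)`. -/
noncomputable def betaZero (N : ℕ) (p : ℝ) : ℝ := ((N : ℝ) - p) / (p - 1)

/-- `ω ∈ W_0^{1,p}(S)` is a weak solution of the spherical `p`-harmonic eigenvalue problem
`-div' ((β² ω² + |∇'ω|²)^{(p-2)/2} ∇'ω) = (p-1) β (β-β₀) (β² ω² + |∇'ω|²)^{(p-2)/2} ω` in `S`,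
`ω = 0` on `∂S`. Where `ω` and `∇'ω` both vanish, the two fields
`(β² ω² + |∇'ω|²)^{(p-2)/2} ∇'ω` and `(β² ω² + |∇'ω|²)^{(p-2)/2} ω` are `0`; for `p > 1` both
integrands below are integrable. -/
def IsW0Solution {N : ℕ} (p β : ℝ) (S : Set (USphere N)) (ω : USphere N → ℝ) : Prop :=
  ∃ G : USphere N → EuclideanSpace ℝ (Fin N), HasW0Gradient p S ω G ∧
    ∀ φ : USphere N → ℝ, IsTestFunction S φ →
      ∫ σ in S, (β ^ 2 * ω σ ^ 2 + ‖G σ‖ ^ 2) ^ ((p - 2) / 2) * inner ℝ (G σ) (sphereGrad φ σ)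
          ∂(surfaceMeasure N) =
        (p - 1) * β * (β - betaZero N p) *
          ∫ σ in S, (β ^ 2 * ω σ ^ 2 + ‖G σ‖ ^ 2) ^ ((p - 2) / 2) * ω σ * φ σ
            ∂(surfaceMeasure N)

/-- The norm of `C^γ(S)` (possibly infinite): the supremum of `|u|` over `S` plus the
`γ`-Hölder seminorm of `u` on `S`. -/
noncomputable def holderNormOn {N : ℕ} (γ : ℝ) (S : Set (USphere N)) (u : USphere N → ℝ) : ℝ≥0∞ :=
  (⨆ σ ∈ S, ‖u σ‖ₑ) + eHolderNorm γ.toNNReal (S.domRestrict u)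

/-! ### Calculus on the sphere through extensions homogeneous of degree zero. -/

section SphereCalculus

variable {N : ℕ}

/-! Everything rests on one energy estimate. Write `A = β²ω² + |G|²` with `G` the gradient of `ω`,
both extended by zero to the whole sphere. Testing the equation with `F ∘ ω`, where `F' ≥ 0` is
bounded and `|t F(t)| ≤ t² F'(t)`, produces `A^((p-2)/2) |G|² F'(ω)` on the left and a zero-order
term bounded by `A^((p-2)/2) ω² F'(ω)` on the right. The latter is absorbed into `½ A^(p/2) F'(ω)`
up to a multiple of `|ω|^p F'(ω)` (`exists_mul_rpow_mul_sq_le`), so that `∫ |G|^p F'(ω) ≤ C ∫ |ω|^p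
F'(ω)` with `C` depending only on `p`, `N`, `β` (`exists_weighted_energy_le`). The domain enters
only through the test functions, hence the uniformity in `S`.

If `p > N - 1`, the choice `F = id` bounds `‖G‖_p` by `‖ω‖_p`, and Morrey's inequality on the
`(N-1)`-dimensional sphere (`exists_sphere_morrey`) concludes. If `p ≤ N - 1`, taking for `F'`
truncated powers of `ε + t²` and applying a Sobolev inequality (`exists_sphere_sobolev`) gives a
gain of integrability at every power, and Moser iteration (`exists_moser_iteration`) gives the sup
bound.

Both functional inequalities are obtained in `ℝ^N` for extensions constant along rays. For Sobolev
this yields only the ambient exponent `Np/(N-p)`, which suffices because the iteration needs just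
some gain. For Morrey the sharp exponent is required; it is recovered because a ball of radius `r`
centred on the sphere lies in a shell of thickness `2r`, over which a ray-constant integrand gains a
factor `r`. -/

theorem radialExt_of_ne_zero (φ : USphere N → ℝ) {x : EuclideanSpace ℝ (Fin N)} (hx : x ≠ 0) :
    radialExt φ x = φ (radialProj x hx) := by
  simp [radialExt, hx]

theorem radialProj_smul {x : EuclideanSpace ℝ (Fin N)} (hx : x ≠ 0) {c : ℝ} (hc : 0 < c)
    (h : c • x ≠ 0) : radialProj (c • x) h = radialProj x hx := by
  apply Subtype.ext
  simp only [radialProj, norm_smul, Real.norm_eq_abs, abs_of_pos hc, smul_smul]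
  congr 1
  field_simp

theorem coe_ne_zero_of_sphere (σ : USphere N) : (σ : EuclideanSpace ℝ (Fin N)) ≠ 0 := by
  have h := norm_eq_of_mem_sphere σ
  intro h0
  rw [h0, norm_zero] at h
  exact zero_ne_one h

theorem radialProj_coe (σ : USphere N) (h : (σ : EuclideanSpace ℝ (Fin N)) ≠ 0) :
    radialProj (σ : EuclideanSpace ℝ (Fin N)) h = σ := by
  apply Subtype.ext
  simp [radialProj]

theorem radialExt_coe (φ : USphere N → ℝ) (σ : USphere N) :
    radialExt φ (σ : EuclideanSpace ℝ (Fin N)) = φ σ := by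
  rw [radialExt_of_ne_zero φ (coe_ne_zero_of_sphere σ), radialProj_coe]

theorem radialExt_smul (φ : USphere N → ℝ) {c : ℝ} (hc : 0 < c) (x : EuclideanSpace ℝ (Fin N)) :
    radialExt φ (c • x) = radialExt φ x := by
  by_cases hx : x = 0
  · simp [hx]
  · have h : c • x ≠ 0 := smul_ne_zero hc.ne' hx
    rw [radialExt_of_ne_zero φ hx, radialExt_of_ne_zero φ h, radialProj_smul hx hc]

theorem continuous_radialProj_subtype :
    Continuous (fun x : ({0}ᶜ : Set (EuclideanSpace ℝ (Fin N))) => radialProj x.1 x.2) := by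
  have h : Continuous fun x : ({0}ᶜ : Set (EuclideanSpace ℝ (Fin N))) => ‖x.1‖ := by fun_prop
  exact ((h.inv₀ (fun x => norm_ne_zero_iff.mpr x.2)).smul continuous_subtype_val).subtype_mk _

theorem SphereSmooth.contDiffAt {φ : USphere N → ℝ} (hφ : SphereSmooth φ)
    {x : EuclideanSpace ℝ (Fin N)} (hx : x ≠ 0) : ContDiffAt ℝ (⊤ : ℕ∞) (radialExt φ) x :=
  ContDiffOn.contDiffAt hφ (isOpen_compl_singleton.mem_nhds hx)

theorem SphereSmooth.differentiableAt {φ : USphere N → ℝ} (hφ : SphereSmooth φ)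
    {x : EuclideanSpace ℝ (Fin N)} (hx : x ≠ 0) : DifferentiableAt ℝ (radialExt φ) x :=
  (hφ.contDiffAt hx).differentiableAt (by simp)

theorem SphereSmooth.continuous {φ : USphere N → ℝ} (hφ : SphereSmooth φ) : Continuous φ := by
  have h : φ = fun σ : USphere N => radialExt φ (σ : EuclideanSpace ℝ (Fin N)) := by
    funext σ; rw [radialExt_coe]
  rw [h]
  exact ContinuousOn.comp_continuous hφ.continuousOn continuous_subtype_val
    coe_ne_zero_of_sphere

theorem SphereSmooth.continuousOn_fderiv {φ : USphere N → ℝ} (hφ : SphereSmooth φ) :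
    ContinuousOn (fderiv ℝ (radialExt φ)) {0}ᶜ :=
  ContDiffOn.continuousOn_fderiv_of_isOpen hφ isOpen_compl_singleton (by simp)

theorem SphereSmooth.continuous_sphereGrad {φ : USphere N → ℝ} (hφ : SphereSmooth φ) :
    Continuous (sphereGrad φ) := by
  unfold sphereGrad gradient
  refine (LinearIsometryEquiv.continuous _).comp ?_
  exact hφ.continuousOn_fderiv.comp_continuous continuous_subtype_val coe_ne_zero_of_sphere

theorem fderiv_radialExt_smul (φ : USphere N → ℝ) {c : ℝ} (hc : 0 < c)
    (x : EuclideanSpace ℝ (Fin N)) :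
    fderiv ℝ (radialExt φ) x = c • fderiv ℝ (radialExt φ) (c • x) := by
  have h : radialExt φ = fun y => radialExt φ (c • y) := by
    funext y; rw [radialExt_smul φ hc]
  conv_lhs => rw [h]
  exact fderiv_comp_smul _

theorem norm_fderiv_radialExt_coe (φ : USphere N → ℝ) (σ : USphere N) :
    ‖fderiv ℝ (radialExt φ) (σ : EuclideanSpace ℝ (Fin N))‖ = ‖sphereGrad φ σ‖ := by
  simp [sphereGrad, gradient]

/-- The differential of a function homogeneous of degree zero is homogeneous of degree `-1`. -/
theorem norm_fderiv_radialExt (φ : USphere N → ℝ) {x : EuclideanSpace ℝ (Fin N)} (hx : x ≠ 0) :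
    ‖fderiv ℝ (radialExt φ) x‖ = ‖x‖⁻¹ * ‖sphereGrad φ (radialProj x hx)‖ := by
  have hc : 0 < ‖x‖⁻¹ := inv_pos.mpr (norm_pos_iff.mpr hx)
  rw [fderiv_radialExt_smul φ hc, norm_smul, ← norm_fderiv_radialExt_coe]
  simp [radialProj]

theorem radialExt_comp_eq (W : ℝ → ℝ) (φ : USphere N → ℝ) {x : EuclideanSpace ℝ (Fin N)}
    (hx : x ≠ 0) : radialExt (W ∘ φ) x = W (radialExt φ x) := by
  simp [radialExt, hx]

theorem SphereSmooth.comp {φ : USphere N → ℝ} (hφ : SphereSmooth φ) {W : ℝ → ℝ}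
    (hW : ContDiff ℝ (⊤ : ℕ∞) W) : SphereSmooth (W ∘ φ) := by
  unfold SphereSmooth
  refine (hW.comp_contDiffOn hφ).congr ?_
  intro x hx
  exact radialExt_comp_eq W φ hx

theorem SphereSmooth.sphereGrad_comp {φ : USphere N → ℝ} (hφ : SphereSmooth φ) {W : ℝ → ℝ}
    (hW : Differentiable ℝ W) (σ : USphere N) :
    sphereGrad (W ∘ φ) σ = deriv W (φ σ) • sphereGrad φ σ := by
  have hσ := coe_ne_zero_of_sphere σ
  have h1 : radialExt (W ∘ φ) =ᶠ[𝓝 (σ : EuclideanSpace ℝ (Fin N))] W ∘ radialExt φ := by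
    filter_upwards [isOpen_compl_singleton.mem_nhds hσ] with x hx
    exact radialExt_comp_eq W φ hx
  have h2 : fderiv ℝ (radialExt (W ∘ φ)) (σ : EuclideanSpace ℝ (Fin N)) =
      deriv W (φ σ) • fderiv ℝ (radialExt φ) (σ : EuclideanSpace ℝ (Fin N)) := by
    rw [h1.fderiv_eq]
    have h3 := (hW (radialExt φ (σ : EuclideanSpace ℝ (Fin N)))).hasDerivAt
    have h4 := h3.comp_hasFDerivAt (σ : EuclideanSpace ℝ (Fin N))
      (hφ.differentiableAt hσ).hasFDerivAt
    rw [h4.fderiv, radialExt_coe]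
  simp [sphereGrad, gradient, h2]

/-- This makes extension by zero outside `S` compatible with gradients of test functions. -/
theorem sphereGrad_eq_zero_of_notMem_tsupport {φ : USphere N → ℝ} {σ : USphere N}
    (hσ : σ ∉ tsupport φ) : sphereGrad φ σ = 0 := by
  have hne := coe_ne_zero_of_sphere σ
  have h0 : φ =ᶠ[𝓝 σ] 0 := notMem_tsupport_iff_eventuallyEq.mp hσ
  have h1 : radialExt φ =ᶠ[𝓝 (σ : EuclideanSpace ℝ (Fin N))] fun _ => 0 := by
    have hopen : ∀ᶠ x in 𝓝 (σ : EuclideanSpace ℝ (Fin N)), x ≠ 0 :=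
      isOpen_compl_singleton.mem_nhds hne
    have h2 : Tendsto (fun x : ({0}ᶜ : Set (EuclideanSpace ℝ (Fin N))) => radialProj x.1 x.2)
        (𝓝 ⟨(σ : EuclideanSpace ℝ (Fin N)), hne⟩) (𝓝 σ) := by
      have := (continuous_radialProj_subtype (N := N)).tendsto
        ⟨(σ : EuclideanSpace ℝ (Fin N)), hne⟩
      rwa [radialProj_coe σ hne] at this
    have h3 := h2.eventually h0
    rw [nhds_subtype, eventually_comap] at h3
    filter_upwards [h3, hopen] with x hx hx0
    rw [radialExt_of_ne_zero φ hx0]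
    exact hx ⟨x, hx0⟩ rfl
  simp [sphereGrad, gradient, h1.fderiv_eq]

theorem IsTestFunction.comp {S : Set (USphere N)} {φ : USphere N → ℝ} (hφ : IsTestFunction S φ)
    {W : ℝ → ℝ} (hW : ContDiff ℝ (⊤ : ℕ∞) W) (hW0 : W 0 = 0) : IsTestFunction S (W ∘ φ) :=
  ⟨hφ.1.comp hW, (closure_mono (Function.support_comp_subset hW0 φ)).trans hφ.2⟩

end SphereCalculus

/-! ### Polar coordinates on spherical shells. -/

section PolarCoordinates

variable {N : ℕ}

instance : IsFiniteMeasure (surfaceMeasure N) := by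
  unfold surfaceMeasure; infer_instance

/-- Bounding the density by its endpoint value is enough: what matters later is the linear
dependence on the thickness `b - a`. -/
theorem volumeIoiPow_Ioo_le {n : ℕ} {a b : ℝ} (ha : 0 ≤ a) (hab : a ≤ b) :
    Measure.volumeIoiPow n ((↑) ⁻¹' Set.Ioo a b) ≤ ENNReal.ofReal (b ^ n * (b - a)) := by
  rw [Measure.volumeIoiPow, withDensity_apply _ (measurable_subtype_coe measurableSet_Ioo),
    setLIntegral_subtype measurableSet_Ioi _ fun a : ℝ ↦ ENNReal.ofReal (a ^ n)]
  have hset : (Subtype.val '' ((↑) ⁻¹' Set.Ioo a b : Set (Set.Ioi (0:ℝ)))) = Set.Ioo a b := by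
    ext x
    simp only [Set.mem_image, Set.mem_preimage, Subtype.exists, Set.mem_Ioi, exists_and_left,
      exists_prop, exists_eq_right_right, and_iff_left_iff_imp]
    exact fun h => lt_of_le_of_lt ha h.1
  rw [hset]
  calc _ ≤ ∫⁻ _ in Set.Ioo a b, ENNReal.ofReal (b ^ n) := by
        refine setLIntegral_mono' measurableSet_Ioo fun x hx => ?_
        exact ENNReal.ofReal_le_ofReal (pow_le_pow_left₀ (ha.trans hx.1.le) hx.2.le n)
    _ = _ := by
        rw [setLIntegral_const, Real.volume_Ioo, ← ENNReal.ofReal_mul (pow_nonneg (ha.trans hab) n)]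

theorem le_volumeIoiPow_Ioo {n : ℕ} {a b : ℝ} (ha : 0 ≤ a) :
    ENNReal.ofReal (a ^ n * (b - a)) ≤ Measure.volumeIoiPow n ((↑) ⁻¹' Set.Ioo a b) := by
  rw [Measure.volumeIoiPow, withDensity_apply _ (measurable_subtype_coe measurableSet_Ioo),
    setLIntegral_subtype measurableSet_Ioi _ fun a : ℝ ↦ ENNReal.ofReal (a ^ n)]
  have hset : (Subtype.val '' ((↑) ⁻¹' Set.Ioo a b : Set (Set.Ioi (0:ℝ)))) = Set.Ioo a b := by
    ext x
    simp only [Set.mem_image, Set.mem_preimage, Subtype.exists, Set.mem_Ioi, exists_and_left,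
      exists_prop, exists_eq_right_right, and_iff_left_iff_imp]
    exact fun h => lt_of_le_of_lt ha h.1
  rw [hset]
  calc _ = ∫⁻ _ in Set.Ioo a b, ENNReal.ofReal (a ^ n) := by
        rw [setLIntegral_const, Real.volume_Ioo, ← ENNReal.ofReal_mul (by positivity)]
    _ ≤ _ := by
        refine setLIntegral_mono' measurableSet_Ioo fun x hx => ?_
        exact ENNReal.ofReal_le_ofReal (pow_le_pow_left₀ ha hx.1.le n)

/-- Integration in polar coordinates over a spherical shell. -/
theorem setLIntegral_shell {f : USphere N → ℝ≥0∞} (hf : Measurable f)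
    {F : EuclideanSpace ℝ (Fin N) → ℝ≥0∞} {a b : ℝ} (ha : 0 ≤ a)
    (hF : ∀ x (hx : x ≠ 0), a < ‖x‖ → ‖x‖ < b → F x = f (radialProj x hx)) :
    ∫⁻ x in {x | ‖x‖ ∈ Set.Ioo a b}, F x =
      Measure.volumeIoiPow (N - 1) ((↑) ⁻¹' Set.Ioo a b) * ∫⁻ σ, f σ ∂(surfaceMeasure N) := by
  classical
  have hms : MeasurableSet {x : EuclideanSpace ℝ (Fin N) | ‖x‖ ∈ Set.Ioo a b} := measurable_norm measurableSet_Ioo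
  have hms' : MeasurableSet ((↑) ⁻¹' Set.Ioo a b : Set (Set.Ioi (0:ℝ))) :=
    measurable_subtype_coe measurableSet_Ioo
  have hmp := (volume : Measure (EuclideanSpace ℝ (Fin N))).measurePreserving_homeomorphUnitSphereProd
  set I : Set (Set.Ioi (0:ℝ)) := (↑) ⁻¹' Set.Ioo a b with hI
  have h1 : ∀ x : ({0}ᶜ : Set (EuclideanSpace ℝ (Fin N))), ({x : EuclideanSpace ℝ (Fin N) | ‖x‖ ∈ Set.Ioo a b}.indicator F) x.1 =
      (fun q : USphere N × Set.Ioi (0:ℝ) => f q.1 * I.indicator 1 q.2)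
        (homeomorphUnitSphereProd (EuclideanSpace ℝ (Fin N)) x) := by
    intro x
    have e1 : (homeomorphUnitSphereProd (EuclideanSpace ℝ (Fin N)) x).1 = radialProj x.1 x.2 := by
      apply Subtype.ext
      simp [radialProj]
    have e2 : ((homeomorphUnitSphereProd (EuclideanSpace ℝ (Fin N)) x).2 : ℝ) = ‖x.1‖ := by simp
    by_cases h : ‖x.1‖ ∈ Set.Ioo a b
    · have h' : (homeomorphUnitSphereProd (EuclideanSpace ℝ (Fin N)) x).2 ∈ I := by
        rw [hI, Set.mem_preimage, e2]; exact h
      simp only [Set.indicator_of_mem h', Pi.one_apply, mul_one, e1]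
      rw [Set.indicator_of_mem (show x.1 ∈ {x : EuclideanSpace ℝ (Fin N) | ‖x‖ ∈ Set.Ioo a b} from h)]
      exact hF _ x.2 h.1 h.2
    · have h' : (homeomorphUnitSphereProd (EuclideanSpace ℝ (Fin N)) x).2 ∉ I := by
        rw [hI, Set.mem_preimage, e2]; exact h
      simp only [Set.indicator_of_notMem h', mul_zero]
      rw [Set.indicator_of_notMem (show x.1 ∉ {x : EuclideanSpace ℝ (Fin N) | ‖x‖ ∈ Set.Ioo a b} from h)]
  rw [← lintegral_indicator hms]
  -- Polar coordinates live on the punctured space; the origin is outside the shell because `0 ≤ a`.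
  have h0 : ∫⁻ x, ({x : EuclideanSpace ℝ (Fin N) | ‖x‖ ∈ Set.Ioo a b}.indicator F) x =
      ∫⁻ x in ({0}ᶜ : Set (EuclideanSpace ℝ (Fin N))), ({x : EuclideanSpace ℝ (Fin N) | ‖x‖ ∈ Set.Ioo a b}.indicator F) x := by
    symm
    rw [← lintegral_indicator (measurableSet_singleton _).compl]
    congr 1
    funext x
    by_cases hx : x = 0
    · subst hx
      rw [Set.indicator_of_notMem (by simp), Set.indicator_of_notMem (by simp [ha])]
    · rw [Set.indicator_of_mem (by simpa using hx)]
  rw [h0, ← lintegral_subtype_comap (measurableSet_singleton _).compl]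
  have hg : Measurable (fun q : USphere N × Set.Ioi (0:ℝ) => f q.1 * I.indicator 1 q.2) :=
    (hf.comp measurable_fst).mul
      (((measurable_one (α := ℝ≥0∞) (β := Set.Ioi (0:ℝ))).indicator hms').comp measurable_snd)
  rw [lintegral_congr h1, hmp.lintegral_comp hg]
  rw [lintegral_prod_mul hf.aemeasurable
    ((measurable_one (α := ℝ≥0∞) (β := Set.Ioi (0:ℝ))).indicator hms').aemeasurable, mul_comm]
  rw [lintegral_indicator_one hms']
  congr 1
  simp

end PolarCoordinates

/-! ### Comparison of `L^p` norms on shells and on the sphere. -/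

section ShellNorms

variable {N : ℕ} {G G' : Type*} [NormedAddCommGroup G] [NormedAddCommGroup G']

/-- `F` is merely dominated along rays, so it may contain a cutoff or the factor `‖x‖⁻¹` of a
differential. -/
theorem eLpNorm_shell_le {f : USphere N → G} (hf : Measurable fun σ => ‖f σ‖ₑ)
    {F : EuclideanSpace ℝ (Fin N) → G'} {a b p : ℝ} (hp : 0 < p) (ha : 0 ≤ a) (hab : a ≤ b)
    (hF : ∀ x (hx : x ≠ 0), a < ‖x‖ → ‖x‖ < b → ‖F x‖ₑ ≤ ‖f (radialProj x hx)‖ₑ) :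
    eLpNorm F (ENNReal.ofReal p) (volume.restrict {x | ‖x‖ ∈ Set.Ioo a b}) ≤
      ENNReal.ofReal (b ^ (N - 1) * (b - a)) ^ (1 / p) *
        eLpNorm f (ENNReal.ofReal p) (surfaceMeasure N) := by
  classical
  have hp0 : ENNReal.ofReal p ≠ 0 := by simpa using hp
  rw [eLpNorm_eq_lintegral_rpow_enorm_toReal hp0 ENNReal.ofReal_ne_top,
    eLpNorm_eq_lintegral_rpow_enorm_toReal hp0 ENNReal.ofReal_ne_top,
    ENNReal.toReal_ofReal hp.le, ← ENNReal.mul_rpow_of_nonneg _ _ (by positivity)]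
  gcongr
  have hms : MeasurableSet {x : EuclideanSpace ℝ (Fin N) | ‖x‖ ∈ Set.Ioo a b} :=
    measurable_norm measurableSet_Ioo
  calc ∫⁻ x in {x | ‖x‖ ∈ Set.Ioo a b}, ‖F x‖ₑ ^ p
      ≤ ∫⁻ x in {x | ‖x‖ ∈ Set.Ioo a b}, (fun x => if hx : x ≠ 0 then
          ‖f (radialProj x hx)‖ₑ ^ p else 0) x := by
        refine setLIntegral_mono' hms fun x hx => ?_
        have hx0 : x ≠ 0 := norm_pos_iff.mp (ha.trans_lt hx.1)
        simp only [dif_pos hx0]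
        exact ENNReal.rpow_le_rpow (hF x hx0 hx.1 hx.2) hp.le
    _ = Measure.volumeIoiPow (N - 1) ((↑) ⁻¹' Set.Ioo a b) *
          ∫⁻ σ, ‖f σ‖ₑ ^ p ∂(surfaceMeasure N) := by
        refine setLIntegral_shell (hf.pow_const p) ha fun x hx _ _ => ?_
        simp [dif_pos hx]
    _ ≤ _ := by gcongr; exact volumeIoiPow_Ioo_le ha hab

theorem le_eLpNorm_shell {f : USphere N → G} (hf : Measurable fun σ => ‖f σ‖ₑ)
    {F : EuclideanSpace ℝ (Fin N) → G'} {a b p : ℝ} (hp : 0 < p) (ha : 0 ≤ a)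
    (hF : ∀ x (hx : x ≠ 0), a < ‖x‖ → ‖x‖ < b → ‖f (radialProj x hx)‖ₑ ≤ ‖F x‖ₑ) :
    ENNReal.ofReal (a ^ (N - 1) * (b - a)) ^ (1 / p) *
        eLpNorm f (ENNReal.ofReal p) (surfaceMeasure N) ≤
      eLpNorm F (ENNReal.ofReal p) (volume.restrict {x | ‖x‖ ∈ Set.Ioo a b}) := by
  classical
  have hp0 : ENNReal.ofReal p ≠ 0 := by simpa using hp
  rw [eLpNorm_eq_lintegral_rpow_enorm_toReal hp0 ENNReal.ofReal_ne_top,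
    eLpNorm_eq_lintegral_rpow_enorm_toReal hp0 ENNReal.ofReal_ne_top,
    ENNReal.toReal_ofReal hp.le, ← ENNReal.mul_rpow_of_nonneg _ _ (by positivity)]
  gcongr
  have hms : MeasurableSet {x : EuclideanSpace ℝ (Fin N) | ‖x‖ ∈ Set.Ioo a b} :=
    measurable_norm measurableSet_Ioo
  calc _ ≤ Measure.volumeIoiPow (N - 1) ((↑) ⁻¹' Set.Ioo a b) *
          ∫⁻ σ, ‖f σ‖ₑ ^ p ∂(surfaceMeasure N) := by gcongr; exact le_volumeIoiPow_Ioo ha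
    _ = ∫⁻ x in {x | ‖x‖ ∈ Set.Ioo a b}, (fun x => if hx : x ≠ 0 then
          ‖f (radialProj x hx)‖ₑ ^ p else 0) x := by
        symm
        refine setLIntegral_shell (hf.pow_const p) ha fun x hx _ _ => ?_
        simp [dif_pos hx]
    _ ≤ _ := by
        refine setLIntegral_mono' hms fun x hx => ?_
        have hx0 : x ≠ 0 := norm_pos_iff.mp (ha.trans_lt hx.1)
        simp only [dif_pos hx0]
        exact ENNReal.rpow_le_rpow (hF x hx0 hx.1 hx.2) hp.le

end ShellNorms

/-! ### Sobolev inequality on the sphere. -/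

section Sobolev

theorem eLpNorm_restrict_of_forall_notMem {α G : Type*} [MeasurableSpace α]
    [NormedAddCommGroup G] {μ : Measure α} {s : Set α} {f : α → G} {q : ℝ≥0∞}
    (h : ∀ x, x ∉ s → f x = 0) : eLpNorm f q (μ.restrict s) = eLpNorm f q μ :=
  eLpNorm_restrict_eq_of_support_subset fun x hx => by
    by_contra hxs
    exact hx (h x hxs)

/-- A ray-constant extension is singular at the origin and not compactly supported; multiplication
by this cutoff cures both defects and changes nothing near the unit sphere. -/
theorem exists_shell_cutoff (E : Type*) [NormedAddCommGroup E] [InnerProductSpace ℝ E]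
    [FiniteDimensional ℝ E] :
    ∃ η : E → ℝ, ContDiff ℝ 1 η ∧ HasCompactSupport η ∧ (∀ x, ‖x‖ < 1 / 2 → η x = 0) ∧
      (∀ x, 2 < ‖x‖ → η x = 0) ∧ (∀ x, 3 / 4 < ‖x‖ → ‖x‖ < 3 / 2 → η x = 1) ∧
      ∀ x, |η x| ≤ 1 := by
  let b1 : ContDiffBump (0 : E) := ⟨3 / 2, 2, by norm_num, by norm_num⟩
  let b2 : ContDiffBump (0 : E) := ⟨1 / 2, 3 / 4, by norm_num, by norm_num⟩
  refine ⟨fun x => b1 x * (1 - b2 x), ?_, ?_, ?_, ?_, ?_, ?_⟩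
  · exact b1.contDiff.mul (contDiff_const.sub b2.contDiff)
  · exact b1.hasCompactSupport.mul_right
  · intro x hx
    have : b2 x = 1 := b2.one_of_mem_closedBall (by
      rw [mem_closedBall_zero_iff]; exact hx.le)
    simp [this]
  · intro x hx
    have : b1 x = 0 := b1.zero_of_le_dist (by
      rw [dist_zero_right]; exact hx.le)
    simp [this]
  · intro x hx hx'
    have h1 : b1 x = 1 := b1.one_of_mem_closedBall (by
      rw [mem_closedBall_zero_iff]; exact hx'.le)
    have h2 : b2 x = 0 := b2.zero_of_le_dist (by
      rw [dist_zero_right]; exact hx.le)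
    simp [h1, h2]
  · intro x
    have h1 := b1.nonneg (x := x)
    have h2 := b1.le_one (x := x)
    have h3 := b2.nonneg (x := x)
    have h4 := b2.le_one (x := x)
    rw [abs_le]
    constructor <;> nlinarith

theorem contDiff_cutoff_mul_radialExt {N : ℕ} {φ : USphere N → ℝ} (hφ : SphereSmooth φ)
    {η : EuclideanSpace ℝ (Fin N) → ℝ} (hη : ContDiff ℝ 1 η)
    (h0 : ∀ x, ‖x‖ < 1 / 2 → η x = 0) : ContDiff ℝ 1 fun x => η x * radialExt φ x := by
  rw [contDiff_iff_contDiffAt]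
  intro x
  by_cases hx : x = 0
  · have : (fun x => η x * radialExt φ x) =ᶠ[𝓝 x] fun _ => 0 := by
      subst hx
      filter_upwards [ball_mem_nhds (0 : EuclideanSpace ℝ (Fin N)) (by norm_num : (0:ℝ) < 1 / 2)]
        with y hy
      rw [h0 y (by simpa using hy), zero_mul]
    exact contDiffAt_const.congr_of_eventuallyEq this
  · exact hη.contDiffAt.mul ((hφ.contDiffAt hx).of_le (by exact_mod_cast le_top))

theorem enorm_fderiv_cutoff_mul_radialExt_le {N : ℕ} {φ : USphere N → ℝ} (hφ : SphereSmooth φ)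
    {η : EuclideanSpace ℝ (Fin N) → ℝ} (hη : ContDiff ℝ 1 η) (hη1 : ∀ x, |η x| ≤ 1)
    {K : ℝ} (hK : ∀ x, ‖fderiv ℝ η x‖ ≤ K) (hK4 : 4 ≤ K)
    {x : EuclideanSpace ℝ (Fin N)} (hx : x ≠ 0) (hx4 : 1 / 4 < ‖x‖) :
    ‖fderiv ℝ (fun x => η x * radialExt φ x) x‖ₑ ≤
      ‖K * (‖φ (radialProj x hx)‖ + ‖sphereGrad φ (radialProj x hx)‖)‖ₑ := by
  have hd := (hη.differentiable (by norm_num) x).hasFDerivAt.mul (hφ.differentiableAt hx).hasFDerivAt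
  have hd' : fderiv ℝ (fun x => η x * radialExt φ x) x = _ := hd.fderiv
  rw [hd', enorm_le_iff_norm_le]
  -- This is why `K` is required to be at least `4`: it also dominates the factor `‖x‖⁻¹` of the
  -- differential.
  have hi : ‖x‖⁻¹ ≤ 4 := by
    rw [inv_le_comm₀ (norm_pos_iff.mpr hx) (by norm_num)]
    linarith
  have hK0 : 0 ≤ K := by linarith
  rw [Real.norm_of_nonneg (by positivity)]
  refine (norm_add_le _ _).trans ?_
  rw [norm_smul, norm_smul, norm_fderiv_radialExt φ hx, radialExt_of_ne_zero φ hx, mul_add,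
    add_comm]
  gcongr ?_ + ?_
  · rw [mul_comm]
    gcongr
    exact hK x
  · have := hη1 x
    calc ‖η x‖ * (‖x‖⁻¹ * ‖sphereGrad φ (radialProj x hx)‖)
        ≤ 1 * (4 * ‖sphereGrad φ (radialProj x hx)‖) := by
          gcongr; exact this
      _ ≤ _ := by rw [one_mul]; gcongr

/-- A Sobolev inequality on the sphere, with the exponent of the ambient dimension. -/
theorem exists_sphere_sobolev {N : ℕ} (hN : 2 ≤ N) {p : ℝ} (hp : 1 ≤ p) (hpN : p < N) :
    ∃ C : ℝ≥0, ∀ φ : USphere N → ℝ, SphereSmooth φ →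
      eLpNorm φ (ENNReal.ofReal (p * (N / (N - p)))) (surfaceMeasure N) ≤
        C * (eLpNorm φ (ENNReal.ofReal p) (surfaceMeasure N) +
          eLpNorm (sphereGrad φ) (ENNReal.ofReal p) (surfaceMeasure N)) := by
  obtain ⟨η, hη, hηc, hη0, hη2, hη1, hηle⟩ := exists_shell_cutoff (EuclideanSpace ℝ (Fin N))
  obtain ⟨K₀, hK₀⟩ := (hηc.fderiv (𝕜 := ℝ)).exists_bound_of_continuous
    (hη.continuous_fderiv (by norm_num))
  set K := max K₀ 4 with hKdef
  have hK : ∀ x, ‖fderiv ℝ η x‖ ≤ K := fun x => (hK₀ x).trans (le_max_left _ _)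
  have hK0 : 0 ≤ K := by rw [hKdef]; positivity
  have hp0 : 0 < p := by linarith
  have hNp : 0 < (N : ℝ) - p := by linarith
  have hN0 : (0:ℝ) < N := by linarith
  set q := p * (N / (N - p)) with hq
  have hq0 : 0 < q := by positivity
  set C₁ := eLpNormLESNormFDerivOfEqInnerConst (volume : Measure (EuclideanSpace ℝ (Fin N)))
    p.toNNReal
  -- `c₁` belongs to the shell where the cutoff is `1` (lower bound for the function), `c₂` to a
  -- larger shell containing its support (upper bound for the differential).
  set c₁ := ENNReal.ofReal ((3/4:ℝ) ^ (N - 1) * (3/2 - 3/4)) ^ (1 / q)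
  set c₂ := ENNReal.ofReal ((3:ℝ) ^ (N - 1) * (3 - 1/4)) ^ (1 / p)
  have hc₁ : c₁ ≠ 0 := by
    refine (ENNReal.rpow_pos ?_ ENNReal.ofReal_ne_top).ne'
    rw [ENNReal.ofReal_pos]; norm_num
  have hc₁' : c₁ ≠ ∞ := ENNReal.rpow_ne_top_of_nonneg (by positivity) ENNReal.ofReal_ne_top
  have hc₂' : c₂ ≠ ∞ := ENNReal.rpow_ne_top_of_nonneg (by positivity) ENNReal.ofReal_ne_top
  have hfin : c₁⁻¹ * (C₁ * (c₂ * ENNReal.ofReal K)) ≠ ∞ :=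
    ENNReal.mul_ne_top (ENNReal.inv_ne_top.mpr hc₁) (ENNReal.mul_ne_top ENNReal.coe_ne_top
      (ENNReal.mul_ne_top hc₂' ENNReal.ofReal_ne_top))
  refine ⟨(c₁⁻¹ * (C₁ * (c₂ * ENNReal.ofReal K))).toNNReal, fun φ hφ => ?_⟩
  rw [ENNReal.coe_toNNReal hfin]
  set u : EuclideanSpace ℝ (Fin N) → ℝ := fun x => η x * radialExt φ x with hu
  have hu1 : ContDiff ℝ 1 u := contDiff_cutoff_mul_radialExt hφ hη hη0
  have hGNS : eLpNorm u (ENNReal.ofReal q) volume ≤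
      C₁ * eLpNorm (fderiv ℝ u) (ENNReal.ofReal p) volume := by
    refine eLpNorm_le_eLpNorm_fderiv_of_eq_inner volume hu1 hηc.mul_right (p := p.toNNReal)
      (p' := q.toNNReal) (by simpa using hp) (by simp; omega) ?_
    rw [NNReal.coe_inv, Real.coe_toNNReal _ hq0.le, Real.coe_toNNReal _ hp0.le, hq]
    simp only [finrank_euclideanSpace, Fintype.card_fin]
    field_simp
  have hgm : Measurable fun σ => ‖sphereGrad φ σ‖ := hφ.continuous_sphereGrad.norm.measurable
  have hfm : Measurable fun σ => ‖φ σ‖ := hφ.continuous.norm.measurable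
  have hlow : c₁ * eLpNorm φ (ENNReal.ofReal q) (surfaceMeasure N) ≤
      eLpNorm u (ENNReal.ofReal q) volume := by
    refine (le_eLpNorm_shell hφ.continuous.measurable.enorm hq0 (by norm_num)
      (F := u) fun x hx h1 h2 => ?_).trans (eLpNorm_mono_measure _ Measure.restrict_le_self)
    rw [hu]
    simp only [hη1 x h1 h2, one_mul, radialExt_of_ne_zero φ hx, le_refl]
  have hup : eLpNorm (fderiv ℝ u) (ENNReal.ofReal p) volume ≤
      c₂ * eLpNorm (fun σ => K * (‖φ σ‖ + ‖sphereGrad φ σ‖)) (ENNReal.ofReal p)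
        (surfaceMeasure N) := by
    have hms : MeasurableSet {x : EuclideanSpace ℝ (Fin N) | ‖x‖ ∈ Set.Ioo (1/4:ℝ) 3} :=
      measurable_norm measurableSet_Ioo
    -- The margins between `1/4` and `1/2` and between `2` and `3` make `u` vanish near `x`, hence
    -- its differential vanishes at `x`.
    have hsupp : ∀ x, x ∉ {x : EuclideanSpace ℝ (Fin N) | ‖x‖ ∈ Set.Ioo (1/4:ℝ) 3} →
        fderiv ℝ u x = 0 := by
      intro x hx'
      have hz : u =ᶠ[𝓝 x] fun _ => 0 := by
        rw [Set.mem_ofPred_eq, Set.mem_Ioo, not_and_or, not_lt, not_lt] at hx'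
        rcases hx' with h | h
        · have : {y : EuclideanSpace ℝ (Fin N) | ‖y‖ < 1 / 2} ∈ 𝓝 x :=
            (isOpen_lt continuous_norm continuous_const).mem_nhds
              (by simp only [Set.mem_ofPred_eq]; linarith)
          filter_upwards [this] with y hy
          simp [hu, hη0 y hy]
        · have : {y : EuclideanSpace ℝ (Fin N) | 2 < ‖y‖} ∈ 𝓝 x :=
            (isOpen_lt continuous_const continuous_norm).mem_nhds
              (by simp only [Set.mem_ofPred_eq]; linarith)
          filter_upwards [this] with y hy
          simp [hu, hη2 y hy]
      rw [hz.fderiv_eq]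
      simp
    have hres : eLpNorm (fderiv ℝ u) (ENNReal.ofReal p)
        (volume.restrict {x | ‖x‖ ∈ Set.Ioo (1/4:ℝ) 3}) =
        eLpNorm (fderiv ℝ u) (ENNReal.ofReal p) volume :=
      eLpNorm_restrict_of_forall_notMem hsupp
    rw [← hres]
    have hm : Measurable fun σ => K * (‖φ σ‖ + ‖sphereGrad φ σ‖) := (hfm.add hgm).const_mul K
    have hb : ∀ x (hx : x ≠ 0), 1 / 4 < ‖x‖ → ‖x‖ < 3 → ‖fderiv ℝ u x‖ₑ ≤
        ‖K * (‖φ (radialProj x hx)‖ + ‖sphereGrad φ (radialProj x hx)‖)‖ₑ := fun x hx h1 _ =>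
      enorm_fderiv_cutoff_mul_radialExt_le hφ hη hηle hK (le_max_right _ _) hx h1
    exact eLpNorm_shell_le (f := fun σ => K * (‖φ σ‖ + ‖sphereGrad φ σ‖)) hm.enorm hp0
      (by norm_num) (by norm_num) hb
  have htri : eLpNorm (fun σ => K * (‖φ σ‖ + ‖sphereGrad φ σ‖)) (ENNReal.ofReal p)
      (surfaceMeasure N) ≤ ENNReal.ofReal K *
        (eLpNorm φ (ENNReal.ofReal p) (surfaceMeasure N) +
          eLpNorm (sphereGrad φ) (ENNReal.ofReal p) (surfaceMeasure N)) := by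
    have e1 : (fun σ => K * (‖φ σ‖ + ‖sphereGrad φ σ‖)) =
        K • ((fun σ => ‖φ σ‖) + fun σ => ‖sphereGrad φ σ‖) := by
      funext σ; simp
    rw [e1, eLpNorm_const_smul, Real.enorm_eq_ofReal hK0]
    gcongr
    refine (eLpNorm_add_le hfm.aestronglyMeasurable hgm.aestronglyMeasurable
      (by simpa using hp)).trans ?_
    rw [eLpNorm_norm, eLpNorm_norm]
  calc eLpNorm φ (ENNReal.ofReal q) (surfaceMeasure N)
      = c₁⁻¹ * (c₁ * eLpNorm φ (ENNReal.ofReal q) (surfaceMeasure N)) := by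
        rw [← mul_assoc, ENNReal.inv_mul_cancel hc₁ hc₁', one_mul]
    _ ≤ c₁⁻¹ * (C₁ * (c₂ * (ENNReal.ofReal K *
        (eLpNorm φ (ENNReal.ofReal p) (surfaceMeasure N) +
          eLpNorm (sphereGrad φ) (ENNReal.ofReal p) (surfaceMeasure N))))) := by
        refine mul_le_mul_right (hlow.trans (hGNS.trans ?_)) _
        refine mul_le_mul_right (hup.trans ?_) _
        exact mul_le_mul_right htri _
    _ = _ := by ring

end Sobolev

/-! ### Morrey inequality on the sphere. -/

section Morrey

theorem setLIntegral_ball_comp_homothety {N : ℕ} (g : EuclideanSpace ℝ (Fin N) → ℝ≥0∞)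
    (hg : Measurable g) (x : EuclideanSpace ℝ (Fin N)) {s t : ℝ} (ht : 0 < t) :
    ∫⁻ z in ball x s, g (x + t • (z - x)) =
      ENNReal.ofReal ((t ^ N)⁻¹) * ∫⁻ z in ball x (t * s), g z := by
  rw [← lintegral_indicator measurableSet_ball, ← lintegral_indicator measurableSet_ball]
  set h := (ball x (t * s)).indicator g with hh
  have hm : Measurable h := hg.indicator measurableSet_ball
  have h1 : ∀ z, (ball x s).indicator (fun z => g (x + t • (z - x))) z =
      (fun y => h (y + (x - t • x))) (t • z) := by
    intro z
    have e : t • z + (x - t • x) = x + t • (z - x) := by rw [smul_sub]; abel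
    have hiff : z ∈ ball x s ↔ x + t • (z - x) ∈ ball x (t * s) := by
      rw [mem_ball_iff_norm, mem_ball_iff_norm, add_sub_cancel_left, norm_smul, Real.norm_eq_abs,
        abs_of_pos ht, mul_lt_mul_iff_right₀ ht]
    simp only [e, hh]
    by_cases hz : z ∈ ball x s
    · rw [Set.indicator_of_mem hz, Set.indicator_of_mem (hiff.mp hz)]
    · rw [Set.indicator_of_notMem hz, Set.indicator_of_notMem (fun h => hz (hiff.mpr h))]
  have hm' : Measurable fun y => h (y + (x - t • x)) := hm.comp (measurable_add_const _)
  rw [lintegral_congr h1, ← lintegral_map hm' (measurable_const_smul t),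
    Measure.map_addHaar_smul volume ht.ne', lintegral_smul_measure,
    lintegral_add_right_eq_self h, abs_of_pos (by positivity)]
  simp

/-- Fundamental theorem of calculus along the segment from `x` to `z`, which is shorter than `s`. -/
theorem enorm_sub_le_lintegral_fderiv {E : Type*} [NormedAddCommGroup E] [NormedSpace ℝ E]
    {u : E → ℝ} {x z : E} {s : ℝ} (hu : ContDiffOn ℝ 1 u (ball x s)) (hz : z ∈ ball x s) :
    ‖u z - u x‖ₑ ≤ ∫⁻ t in Set.Ioc (0:ℝ) 1,
      ENNReal.ofReal s * ‖fderiv ℝ u (x + t • (z - x))‖ₑ := by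
  have hzs : ‖z - x‖ < s := mem_ball_iff_norm.mp hz
  have hmem : ∀ t ∈ Set.Icc (0:ℝ) 1, x + t • (z - x) ∈ ball x s := by
    intro t ht
    rw [mem_ball_iff_norm, add_sub_cancel_left, norm_smul, Real.norm_eq_abs, abs_of_nonneg ht.1]
    calc t * ‖z - x‖ ≤ 1 * ‖z - x‖ := by gcongr; exact ht.2
      _ < s := by rwa [one_mul]
  have hline : ∀ t : ℝ, HasDerivAt (fun t : ℝ => x + t • (z - x)) (z - x) t := by
    intro t
    simpa using ((hasDerivAt_id t).smul_const (z - x)).const_add x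
  have hderiv : ∀ t ∈ Set.uIcc (0:ℝ) 1, HasDerivAt (fun t : ℝ => u (x + t • (z - x)))
      (fderiv ℝ u (x + t • (z - x)) (z - x)) t := by
    intro t ht
    rw [Set.uIcc_of_le zero_le_one] at ht
    have hd := (hu.contDiffAt (isOpen_ball.mem_nhds (hmem t ht))).differentiableAt (by norm_num)
    exact hd.hasFDerivAt.comp_hasDerivAt t (hline t)
  have hcont : ContinuousOn (fun t : ℝ => fderiv ℝ u (x + t • (z - x)) (z - x))
      (Set.uIcc (0:ℝ) 1) := by
    rw [Set.uIcc_of_le zero_le_one]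
    refine ContinuousOn.clm_apply ?_ continuousOn_const
    exact (hu.continuousOn_fderiv_of_isOpen isOpen_ball (by norm_num)).comp
      (by fun_prop) hmem
  have hftc := intervalIntegral.integral_eq_sub_of_hasDerivAt hderiv hcont.intervalIntegrable
  simp only [one_smul, add_sub_cancel, zero_smul, add_zero] at hftc
  rw [← hftc, intervalIntegral.integral_of_le zero_le_one]
  refine (enorm_integral_le_lintegral_enorm _).trans (lintegral_mono fun t => ?_)
  rw [← Real.enorm_of_nonneg ((norm_nonneg _).trans hzs.le), mul_comm]
  refine (ContinuousLinearMap.le_opENorm _ _).trans ?_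
  gcongr
  rw [enorm_le_iff_norm_le, Real.norm_of_nonneg ((norm_nonneg _).trans hzs.le)]
  exact hzs.le

/-- Morrey's growth condition on the gradient controls the mean oscillation about the centre. -/
theorem lintegral_ball_enorm_sub_le {N : ℕ} {u : EuclideanSpace ℝ (Fin N) → ℝ}
    {x : EuclideanSpace ℝ (Fin N)} {s γ : ℝ} {K : ℝ≥0∞} (hs : 0 < s) (hγ : 0 < γ)
    (hu : ContDiffOn ℝ 1 u (ball x s))
    (hK : ∀ r, 0 < r → r ≤ s →
      ∫⁻ z in ball x r, ‖fderiv ℝ u z‖ₑ ≤ K * ENNReal.ofReal (r ^ ((N:ℝ) - 1 + γ))) :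
    ∫⁻ z in ball x s, ‖u z - u x‖ₑ ≤ K * ENNReal.ofReal (γ⁻¹ * s ^ ((N:ℝ) + γ)) := by
  have hgm : Measurable fun z => ‖fderiv ℝ u z‖ₑ := (measurable_fderiv ℝ u).enorm
  calc ∫⁻ z in ball x s, ‖u z - u x‖ₑ
      ≤ ∫⁻ z in ball x s, ∫⁻ t in Set.Ioc (0:ℝ) 1,
          ENNReal.ofReal s * ‖fderiv ℝ u (x + t • (z - x))‖ₑ :=
        setLIntegral_mono' measurableSet_ball fun z hz => enorm_sub_le_lintegral_fderiv hu hz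
    _ = ∫⁻ t in Set.Ioc (0:ℝ) 1, ∫⁻ z in ball x s,
          ENNReal.ofReal s * ‖fderiv ℝ u (x + t • (z - x))‖ₑ := by
        refine lintegral_lintegral_swap (Measurable.aemeasurable ?_)
        refine Measurable.const_mul ?_ _
        refine hgm.comp ?_
        fun_prop
    -- For fixed `t` the homothety of ratio `t` turns the inner integral into one over the ball of
    -- radius `t s`. Its bound is `s · t^(-N) · (t s)^(N-1+γ) = s^(N+γ) t^(γ-1)`, integrable in `t`
    -- because `γ > 0`.
    _ ≤ ∫⁻ t in Set.Ioc (0:ℝ) 1, K * ENNReal.ofReal (s ^ ((N:ℝ) + γ)) *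
          ENNReal.ofReal (t ^ (γ - 1)) := by
        refine setLIntegral_mono' measurableSet_Ioc fun t ht => ?_
        have ht0 : 0 < t := ht.1
        have hgm' : Measurable fun z => ‖fderiv ℝ u (x + t • (z - x))‖ₑ :=
          hgm.comp (g := fun z => ‖fderiv ℝ u z‖ₑ) (by fun_prop)
        rw [lintegral_const_mul _ hgm',
          setLIntegral_ball_comp_homothety _ hgm x ht0]
        have h1 := hK (t * s) (by positivity) (by nlinarith [ht.2])
        calc _ ≤ ENNReal.ofReal s * (ENNReal.ofReal ((t ^ N)⁻¹) *
              (K * ENNReal.ofReal ((t * s) ^ ((N:ℝ) - 1 + γ)))) := by gcongr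
          _ = K * ENNReal.ofReal (s * ((t ^ N)⁻¹ * (t * s) ^ ((N:ℝ) - 1 + γ))) := by
              rw [ENNReal.ofReal_mul hs.le, ENNReal.ofReal_mul (by positivity)]
              ring
          _ = K * ENNReal.ofReal (s ^ ((N:ℝ) + γ) * t ^ (γ - 1)) := by
              congr 2
              rw [Real.mul_rpow ht0.le hs.le, ← Real.rpow_natCast t N, ← Real.rpow_neg ht0.le]
              have e1 : s ^ ((N:ℝ) + γ) = s * s ^ ((N:ℝ) - 1 + γ) := by
                rw [← Real.rpow_one_add' hs.le]
                · congr 1; ring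
                · intro h
                  have := Nat.cast_nonneg (α := ℝ) N
                  linarith
              have e2 : t ^ (γ - 1) = t ^ (-(N:ℝ)) * t ^ ((N:ℝ) - 1 + γ) := by
                rw [← Real.rpow_add ht0]; congr 1; ring
              rw [e1, e2]; ring
          _ = _ := by
              rw [ENNReal.ofReal_mul (by positivity)]; ring
    _ = _ := by
        rw [lintegral_const_mul _ (by fun_prop)]
        have hint : ∫⁻ t in Set.Ioc (0:ℝ) 1, ENNReal.ofReal (t ^ (γ - 1)) =
            ENNReal.ofReal γ⁻¹ := by
          rw [← ofReal_integral_eq_lintegral_ofReal]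
          · rw [← intervalIntegral.integral_of_le zero_le_one,
              integral_rpow (Or.inl (by linarith))]
            simp [hγ.ne']
          · exact (intervalIntegral.intervalIntegrable_rpow' (by linarith)).1
          · refine (ae_restrict_iff' measurableSet_Ioc).mpr (ae_of_all _ fun t ht => ?_)
            exact Real.rpow_nonneg ht.1.le _
        rw [hint, mul_assoc, ← ENNReal.ofReal_mul (by positivity), mul_comm γ⁻¹]

theorem volume_ball_eq {N : ℕ} (x : EuclideanSpace ℝ (Fin N)) {r : ℝ} (hr : 0 < r) :
    volume (ball x r) =
      ENNReal.ofReal (r ^ N) * volume (ball (0 : EuclideanSpace ℝ (Fin N)) 1) := by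
  rw [Measure.addHaar_ball_of_pos _ _ hr]
  simp

/-- The source of the sharp Hölder exponent: the shell has thickness proportional to `r`. -/
theorem ball_subset_shell {N : ℕ} {x : EuclideanSpace ℝ (Fin N)} (hx : ‖x‖ = 1) (r : ℝ) :
    ball x r ⊆ {z | ‖z‖ ∈ Set.Ioo (1 - r) (1 + r)} := by
  intro z hz
  have h := mem_ball_iff_norm.mp hz
  have h1 := abs_norm_sub_norm_le z x
  rw [hx] at h1
  have h2 := abs_le.mp (h1.trans h.le)
  have h3 := abs_lt.mp (h1.trans_lt h)
  exact ⟨by linarith [h3.1], by linarith [h3.2]⟩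

theorem contDiffOn_radialExt_ball {N : ℕ} {φ : USphere N → ℝ} (hφ : SphereSmooth φ)
    {x : EuclideanSpace ℝ (Fin N)} (hx : ‖x‖ = 1) {r : ℝ} (hr : r ≤ 1) :
    ContDiffOn ℝ 1 (radialExt φ) (ball x r) := by
  refine (ContDiffOn.of_le hφ (by exact_mod_cast le_top)).mono fun z hz => ?_
  have := (ball_subset_shell hx r hz).1
  exact norm_pos_iff.mp (by linarith)

/-- The gradient of the radial extension satisfies Morrey's growth condition with the exponent
of the dimension of the sphere. -/
theorem exists_lintegral_ball_fderiv_radialExt_le (N : ℕ) {p : ℝ} (hp : 1 < p) :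
    ∃ C : ℝ≥0, ∀ φ : USphere N → ℝ, SphereSmooth φ → ∀ x : EuclideanSpace ℝ (Fin N), ‖x‖ = 1 →
      ∀ r, 0 < r → r ≤ 1 / 2 →
        ∫⁻ z in ball x r, ‖fderiv ℝ (radialExt φ) z‖ₑ ≤
          C * eLpNorm (sphereGrad φ) (ENNReal.ofReal p) (surfaceMeasure N) *
            ENNReal.ofReal (r ^ ((N:ℝ) - 1 + (1 - ((N:ℝ) - 1) / p))) := by
  have hp0 : 0 < p := by linarith
  set V := volume (ball (0 : EuclideanSpace ℝ (Fin N)) 1) with hV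
  have hVfin : V ≠ ∞ := measure_ball_lt_top.ne
  have hp1 : 0 ≤ 1 - 1 / p := by
    rw [sub_nonneg, div_le_one hp0]; exact hp.le
  set D := ENNReal.ofReal ((3 / 2 : ℝ) ^ (N - 1) * 2) ^ (1 / p) * 2 * V ^ (1 - 1 / p) with hD
  have hDfin : D ≠ ∞ := ENNReal.mul_ne_top (ENNReal.mul_ne_top
    (ENNReal.rpow_ne_top_of_nonneg (by positivity) ENNReal.ofReal_ne_top) (by simp))
    (ENNReal.rpow_ne_top_of_nonneg hp1 hVfin)
  refine ⟨D.toNNReal, fun φ hφ x hx r hr hr2 => ?_⟩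
  rw [ENNReal.coe_toNNReal hDfin]
  set M := eLpNorm (sphereGrad φ) (ENNReal.ofReal p) (surfaceMeasure N) with hM
  have hshell : eLpNorm (fderiv ℝ (radialExt φ)) (ENNReal.ofReal p)
      (volume.restrict {z | ‖z‖ ∈ Set.Ioo (1 - r) (1 + r)}) ≤
      ENNReal.ofReal ((1 + r) ^ (N - 1) * ((1 + r) - (1 - r))) ^ (1 / p) * (2 * M) := by
    -- The factor `2` bounds `‖z‖⁻¹` on the shell, since `r ≤ 1 / 2`.
    have e : eLpNorm (fun σ => (2:ℝ) • sphereGrad φ σ) (ENNReal.ofReal p) (surfaceMeasure N) =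
        2 * M := by
      rw [show (fun σ => (2:ℝ) • sphereGrad φ σ) = (2:ℝ) • sphereGrad φ from rfl,
        eLpNorm_const_smul, Real.enorm_eq_ofReal (by norm_num)]
      simp [hM]
    rw [← e]
    refine eLpNorm_shell_le (f := fun σ => (2:ℝ) • sphereGrad φ σ)
      (F := fderiv ℝ (radialExt φ)) ?_ hp0 (by linarith) (by linarith) ?_
    · exact (hφ.continuous_sphereGrad.const_smul (2:ℝ)).enorm.measurable
    · intro z hz h1 _
      rw [enorm_le_iff_norm_le, norm_fderiv_radialExt φ hz, norm_smul]
      gcongr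
      rw [Real.norm_of_nonneg (by norm_num), inv_le_comm₀ (norm_pos_iff.mpr hz) (by norm_num)]
      linarith
  calc ∫⁻ z in ball x r, ‖fderiv ℝ (radialExt φ) z‖ₑ
      = eLpNorm (fderiv ℝ (radialExt φ)) 1 (volume.restrict (ball x r)) := by
        rw [eLpNorm_one_eq_lintegral_enorm]
    _ ≤ eLpNorm (fderiv ℝ (radialExt φ)) (ENNReal.ofReal p) (volume.restrict (ball x r)) *
          volume (ball x r) ^ (1 - 1 / p) := by
        have h := eLpNorm_le_eLpNorm_mul_rpow_measure_univ (μ := volume.restrict (ball x r))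
          (f := fderiv ℝ (radialExt φ)) (p := 1) (q := ENNReal.ofReal p)
          (by simpa using hp.le) (measurable_fderiv ℝ _).aestronglyMeasurable
        simpa [ENNReal.toReal_ofReal hp0.le] using h
    _ ≤ (ENNReal.ofReal ((1 + r) ^ (N - 1) * ((1 + r) - (1 - r))) ^ (1 / p) * (2 * M)) *
          (ENNReal.ofReal (r ^ N) * V) ^ (1 - 1 / p) := by
        rw [volume_ball_eq x hr]
        gcongr
        exact (eLpNorm_mono_measure _ (Measure.restrict_mono (ball_subset_shell hx r) le_rfl)).trans
          hshell
    _ ≤ (ENNReal.ofReal ((3 / 2 : ℝ) ^ (N - 1) * 2 * r) ^ (1 / p) * (2 * M)) *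
          (ENNReal.ofReal (r ^ N) * V) ^ (1 - 1 / p) := by
        gcongr ENNReal.ofReal ?_ ^ _ * _ * _
        rw [mul_assoc]
        have h1 : 1 + r - (1 - r) = 2 * r := by ring
        rw [h1]
        gcongr
        linarith
    -- The thickness of the shell gives `r^(1/p)` and Hölder's inequality on the ball gives
    -- `r^(N(1-1/p))`; together they make the exponent `N - 1 + γ` with `γ = 1 - (N-1)/p`.
    _ = D * M * ((ENNReal.ofReal r) ^ (1 / p) * ENNReal.ofReal (r ^ N) ^ (1 - 1 / p)) := by
        rw [hD, ENNReal.ofReal_mul (by positivity), ENNReal.mul_rpow_of_nonneg _ _ (by positivity),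
          ENNReal.mul_rpow_of_nonneg _ _ hp1]
        ring
    _ = _ := by
        congr 1
        rw [ENNReal.ofReal_rpow_of_pos hr, ENNReal.ofReal_rpow_of_pos (by positivity),
          ← ENNReal.ofReal_mul (by positivity), ← Real.rpow_natCast r N, ← Real.rpow_mul hr.le,
          ← Real.rpow_add hr]
        congr 2
        field_simp
        ring

theorem exists_lintegral_ball_radialExt_sub_le (N : ℕ) {p : ℝ} (hp : 1 < p)
    (hNp : (N:ℝ) - 1 < p) :
    ∃ C : ℝ≥0, ∀ φ : USphere N → ℝ, SphereSmooth φ → ∀ x : EuclideanSpace ℝ (Fin N), ‖x‖ = 1 →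
      ∀ s, 0 < s → s ≤ 1 / 2 →
        ∫⁻ z in ball x s, ‖radialExt φ z - radialExt φ x‖ₑ ≤
          C * eLpNorm (sphereGrad φ) (ENNReal.ofReal p) (surfaceMeasure N) *
            ENNReal.ofReal (s ^ ((N:ℝ) + (1 - ((N:ℝ) - 1) / p))) := by
  obtain ⟨C, hC⟩ := exists_lintegral_ball_fderiv_radialExt_le N hp
  set γ := 1 - ((N:ℝ) - 1) / p with hγdef
  have hγ : 0 < γ := by
    rw [hγdef, sub_pos, div_lt_one (by linarith)]; exact hNp
  refine ⟨C * γ⁻¹.toNNReal, fun φ hφ x hx s hs hs2 => ?_⟩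
  refine (lintegral_ball_enorm_sub_le hs hγ (contDiffOn_radialExt_ball hφ hx (by linarith))
    fun r hr hrs => hC φ hφ x hx r hr (hrs.trans hs2)).trans (le_of_eq ?_)
  rw [ENNReal.ofReal_mul (by positivity), ENNReal.coe_mul]
  change _ = C * ENNReal.ofReal γ⁻¹ * _ * _
  ring

/-- Average `|u x - u y| ≤ |u z - u x| + |u z - u y|` over the ball of radius `ρ / 2` about the
midpoint, which lies in both balls of radius `ρ` about `x` and `y`. -/
theorem exists_edist_le_of_dist_le_half {N : ℕ} {p : ℝ} (hp : 1 < p) (hNp : (N:ℝ) - 1 < p) :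
    ∃ C : ℝ≥0, ∀ φ : USphere N → ℝ, SphereSmooth φ → ∀ σ τ : USphere N, dist σ τ ≤ 1 / 2 →
      edist (φ σ) (φ τ) ≤ C * eLpNorm (sphereGrad φ) (ENNReal.ofReal p) (surfaceMeasure N) *
        ENNReal.ofReal (dist σ τ ^ (1 - ((N:ℝ) - 1) / p)) := by
  obtain ⟨C, hC⟩ := exists_lintegral_ball_radialExt_sub_le N hp hNp
  set γ := 1 - ((N:ℝ) - 1) / p with hγdef
  set V := volume (ball (0 : EuclideanSpace ℝ (Fin N)) 1) with hV
  have hVfin : V ≠ ∞ := measure_ball_lt_top.ne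
  have hV0 : V ≠ 0 := (measure_ball_pos _ _ one_pos).ne'
  set D : ℝ≥0∞ := V⁻¹ * ENNReal.ofReal (2 ^ N) * 2 * C with hD
  have hDfin : D ≠ ∞ := by
    rw [hD]
    exact ENNReal.mul_ne_top (ENNReal.mul_ne_top (ENNReal.mul_ne_top
      (ENNReal.inv_ne_top.mpr hV0) ENNReal.ofReal_ne_top) (by simp)) ENNReal.coe_ne_top
  refine ⟨D.toNNReal, fun φ hφ σ τ hστ => ?_⟩
  rw [ENNReal.coe_toNNReal hDfin]
  rcases eq_or_ne σ τ with rfl | hne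
  · simp
  set M := eLpNorm (sphereGrad φ) (ENNReal.ofReal p) (surfaceMeasure N) with hM
  set ρ := dist σ τ with hρ
  have hρ0 : 0 < ρ := dist_pos.mpr hne
  set x : EuclideanSpace ℝ (Fin N) := σ.1
  set y : EuclideanSpace ℝ (Fin N) := τ.1
  have hxy : dist x y = ρ := rfl
  set m := midpoint ℝ x y
  have hx : ‖x‖ = 1 := norm_eq_of_mem_sphere σ
  have hy : ‖y‖ = 1 := norm_eq_of_mem_sphere τ
  have hbx : ball m (ρ / 2) ⊆ ball x ρ := by
    refine ball_subset_ball' ?_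
    rw [dist_midpoint_left, hxy]
    norm_num
    linarith
  have hby : ball m (ρ / 2) ⊆ ball y ρ := by
    refine ball_subset_ball' ?_
    rw [dist_midpoint_right, hxy]
    norm_num
    linarith
  set u := radialExt φ with hu
  have hum : ∀ c : ℝ, AEMeasurable (fun z => ‖u z - c‖ₑ) (volume.restrict (ball m (ρ / 2))) := by
    intro c
    have h1 : ContinuousOn u (ball m (ρ / 2)) :=
      (contDiffOn_radialExt_ball hφ hx (by linarith)).continuousOn.mono hbx
    exact ((h1.aemeasurable measurableSet_ball).sub_const c).enorm
  have key : ‖u x - u y‖ₑ * (ENNReal.ofReal ((ρ / 2) ^ N) * V) ≤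
      2 * (C * M * ENNReal.ofReal (ρ ^ ((N:ℝ) + γ))) := by
    calc ‖u x - u y‖ₑ * (ENNReal.ofReal ((ρ / 2) ^ N) * V)
        = ∫⁻ _ in ball m (ρ / 2), ‖u x - u y‖ₑ := by
          rw [setLIntegral_const, volume_ball_eq m (by positivity)]
      _ ≤ ∫⁻ z in ball m (ρ / 2), (‖u z - u x‖ₑ + ‖u z - u y‖ₑ) := by
          refine lintegral_mono fun z => ?_
          rw [← edist_eq_enorm_sub, ← edist_eq_enorm_sub, ← edist_eq_enorm_sub,
            edist_comm (u z) (u x)]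
          exact edist_triangle _ _ _
      _ = (∫⁻ z in ball m (ρ / 2), ‖u z - u x‖ₑ) + ∫⁻ z in ball m (ρ / 2), ‖u z - u y‖ₑ :=
          lintegral_add_left' (hum _) _
      _ ≤ (∫⁻ z in ball x ρ, ‖u z - u x‖ₑ) + ∫⁻ z in ball y ρ, ‖u z - u y‖ₑ :=
          add_le_add (lintegral_mono_set hbx) (lintegral_mono_set hby)
      _ ≤ _ := by
          rw [two_mul]
          exact add_le_add (hC φ hφ x hx ρ hρ0 hστ) (hC φ hφ y hy ρ hρ0 hστ)
  have hball0 : ENNReal.ofReal ((ρ / 2) ^ N) ≠ 0 := by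
    exact (ENNReal.ofReal_pos.mpr (by positivity)).ne'
  have hσ : edist (φ σ) (φ τ) = ‖u x - u y‖ₑ := by
    rw [edist_eq_enorm_sub, hu, radialExt_coe, radialExt_coe]
  rw [hσ, ← mul_one ‖u x - u y‖ₑ,
    ← ENNReal.mul_inv_cancel (mul_ne_zero hball0 hV0) (ENNReal.mul_ne_top ENNReal.ofReal_ne_top
      hVfin), ← mul_assoc]
  refine (mul_le_mul_left key _).trans (le_of_eq ?_)
  rw [ENNReal.mul_inv (Or.inl hball0) (Or.inr hV0), ← ENNReal.ofReal_inv_of_pos (by positivity)]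
  have e : ENNReal.ofReal (ρ ^ ((N:ℝ) + γ)) * ENNReal.ofReal (((ρ / 2) ^ N)⁻¹) =
      ENNReal.ofReal (2 ^ N) * ENNReal.ofReal (ρ ^ γ) := by
    rw [← ENNReal.ofReal_mul (by positivity), ← ENNReal.ofReal_mul (by positivity),
      Real.rpow_add hρ0, Real.rpow_natCast]
    congr 1
    rw [div_pow]
    field_simp
  calc _ = V⁻¹ * 2 * C * M * (ENNReal.ofReal (ρ ^ ((N:ℝ) + γ)) *
        ENNReal.ofReal (((ρ / 2) ^ N)⁻¹)) := by ring
    _ = _ := by rw [e, hD]; ring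

/-- Average `|u x| ≤ |u z| + |u z - u x|` over the ball of radius `1/2`: the first term is
controlled by the `L^p` norm, the second by the oscillation estimate. -/
theorem exists_enorm_le_sphere {N : ℕ} {p : ℝ} (hp : 1 < p) (hNp : (N:ℝ) - 1 < p) :
    ∃ C : ℝ≥0, ∀ φ : USphere N → ℝ, SphereSmooth φ → ∀ σ : USphere N,
      ‖φ σ‖ₑ ≤ C * (eLpNorm φ (ENNReal.ofReal p) (surfaceMeasure N) +
        eLpNorm (sphereGrad φ) (ENNReal.ofReal p) (surfaceMeasure N)) := by
  obtain ⟨C, hC⟩ := exists_lintegral_ball_radialExt_sub_le N hp hNp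
  have hp0 : 0 < p := by linarith
  set c := ENNReal.ofReal (((1/2:ℝ)) ^ ((N:ℝ) + (1 - ((N:ℝ) - 1) / p)))
  set V := volume (ball (0 : EuclideanSpace ℝ (Fin N)) (1/2)) with hV
  have hVfin : V ≠ ∞ := measure_ball_lt_top.ne
  have hV0 : V ≠ 0 := (measure_ball_pos _ _ (by norm_num)).ne'
  set a := ENNReal.ofReal ((1 + 1/2:ℝ) ^ (N - 1) * ((1 + 1/2) - (1 - 1/2))) ^ (1 / (1:ℝ)) with ha
  have hafin : a ≠ ∞ := ENNReal.rpow_ne_top_of_nonneg (by positivity) ENNReal.ofReal_ne_top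
  set b := surfaceMeasure N Set.univ ^ (1 - 1 / p) with hb
  have hp1 : 0 ≤ 1 - 1 / p := by
    rw [sub_nonneg, div_le_one hp0]; exact hp.le
  have hbfin : b ≠ ∞ := ENNReal.rpow_ne_top_of_nonneg hp1 (measure_ne_top _ _)
  set D : ℝ≥0∞ := V⁻¹ * (a * b + C * c) with hD
  have hDfin : D ≠ ∞ := ENNReal.mul_ne_top (ENNReal.inv_ne_top.mpr hV0)
    (ENNReal.add_ne_top.mpr ⟨ENNReal.mul_ne_top hafin hbfin,
      ENNReal.mul_ne_top ENNReal.coe_ne_top ENNReal.ofReal_ne_top⟩)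
  refine ⟨D.toNNReal, fun φ hφ σ => ?_⟩
  rw [ENNReal.coe_toNNReal hDfin]
  set M₀ := eLpNorm φ (ENNReal.ofReal p) (surfaceMeasure N) with hM₀
  set M := eLpNorm (sphereGrad φ) (ENNReal.ofReal p) (surfaceMeasure N) with hM
  set x : EuclideanSpace ℝ (Fin N) := σ.1
  have hx : ‖x‖ = 1 := norm_eq_of_mem_sphere σ
  set u := radialExt φ with hu
  have hum : AEMeasurable (fun z => ‖u z‖ₑ) (volume.restrict (ball x (1/2))) := by
    have h1 : ContinuousOn u (ball x (1/2)) :=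
      (contDiffOn_radialExt_ball hφ hx (by norm_num)).continuousOn
    exact (h1.aemeasurable measurableSet_ball).enorm
  have hshell : ∫⁻ z in ball x (1/2), ‖u z‖ₑ ≤ a * (b * M₀) := by
    have h1 := eLpNorm_shell_le (f := φ) (F := u) hφ.continuous.measurable.enorm
      (a := 1 - 1/2) (b := 1 + 1/2) (p := 1) one_pos (by norm_num) (by norm_num)
      (fun z hz _ _ => by rw [hu, radialExt_of_ne_zero φ hz])
    have h2 : eLpNorm φ (ENNReal.ofReal 1) (surfaceMeasure N) ≤ b * M₀ := by
      have h := eLpNorm_le_eLpNorm_mul_rpow_measure_univ (μ := surfaceMeasure N)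
        (f := φ) (p := 1) (q := ENNReal.ofReal p)
        (by simpa using hp.le) hφ.continuous.aestronglyMeasurable
      rw [mul_comm, ENNReal.ofReal_one]
      simpa [ENNReal.toReal_ofReal hp0.le, hb, hM₀] using h
    calc ∫⁻ z in ball x (1/2), ‖u z‖ₑ
        ≤ ∫⁻ z in {z | ‖z‖ ∈ Set.Ioo (1 - 1/2 : ℝ) (1 + 1/2)}, ‖u z‖ₑ :=
          lintegral_mono_set (ball_subset_shell hx _)
      _ = eLpNorm u (ENNReal.ofReal 1)
            (volume.restrict {z | ‖z‖ ∈ Set.Ioo (1 - 1/2 : ℝ) (1 + 1/2)}) := by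
          rw [ENNReal.ofReal_one, eLpNorm_one_eq_lintegral_enorm]
      _ ≤ _ := h1.trans (mul_le_mul_right h2 _)
  have key : ‖u x‖ₑ * V ≤ (a * b + C * c) * (M₀ + M) := by
    calc ‖u x‖ₑ * V = ∫⁻ _ in ball x (1/2), ‖u x‖ₑ := by
          rw [setLIntegral_const, hV, Measure.addHaar_ball_center volume x]
      _ ≤ ∫⁻ z in ball x (1/2), (‖u z‖ₑ + ‖u z - u x‖ₑ) := by
          refine lintegral_mono fun z => ?_
          have h := enorm_sub_le (a := u z) (b := u z - u x)
          rwa [sub_sub_cancel] at h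
      _ = (∫⁻ z in ball x (1/2), ‖u z‖ₑ) + ∫⁻ z in ball x (1/2), ‖u z - u x‖ₑ :=
          lintegral_add_left' hum _
      _ ≤ a * (b * M₀) + C * M * c :=
          add_le_add hshell (hC φ hφ x hx (1/2) (by norm_num) le_rfl)
      _ ≤ a * (b * (M₀ + M)) + C * (M₀ + M) * c := by gcongr <;> simp
      _ = _ := by ring
  have hσ : ‖φ σ‖ₑ = ‖u x‖ₑ := by rw [hu, radialExt_coe]
  rw [hσ, ← mul_one ‖u x‖ₑ, ← ENNReal.mul_inv_cancel hV0 hVfin, ← mul_assoc]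
  refine (mul_le_mul_left key _).trans (le_of_eq ?_)
  rw [hD]; ring

/-- **Morrey's inequality** on the sphere `S^{N-1}` for smooth functions. -/
theorem exists_sphere_morrey {N : ℕ} {p : ℝ} (hp : 1 < p) (hNp : (N:ℝ) - 1 < p) :
    ∃ C : ℝ≥0, ∀ φ : USphere N → ℝ, SphereSmooth φ →
      (∀ σ : USphere N,
        ‖φ σ‖ₑ ≤ C * (eLpNorm φ (ENNReal.ofReal p) (surfaceMeasure N) +
          eLpNorm (sphereGrad φ) (ENNReal.ofReal p) (surfaceMeasure N))) ∧
      ∀ σ τ : USphere N, edist (φ σ) (φ τ) ≤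
        C * (eLpNorm φ (ENNReal.ofReal p) (surfaceMeasure N) +
          eLpNorm (sphereGrad φ) (ENNReal.ofReal p) (surfaceMeasure N)) *
          edist σ τ ^ (1 - ((N:ℝ) - 1) / p) := by
  obtain ⟨C₁, hC₁⟩ := exists_edist_le_of_dist_le_half hp hNp
  obtain ⟨C₂, hC₂⟩ := exists_enorm_le_sphere hp hNp
  set γ := 1 - ((N:ℝ) - 1) / p with hγdef
  have hγ : 0 < γ := by
    rw [hγdef, sub_pos, div_lt_one (by linarith)]; exact hNp
  set k : ℝ≥0 := (2 : ℝ≥0) ^ γ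
  have hk : 1 ≤ k := NNReal.one_le_rpow (by norm_num) hγ.le
  have h1 : C₂ ≤ C₁ + 2 * k * C₂ := by
    calc C₂ = 1 * 1 * C₂ := by ring
      _ ≤ 2 * k * C₂ := by gcongr; norm_num
      _ ≤ _ := le_add_self
  refine ⟨C₁ + 2 * k * C₂, fun φ hφ => ⟨fun σ => (hC₂ φ hφ σ).trans ?_, fun σ τ => ?_⟩⟩
  · gcongr
  set M₀ := eLpNorm φ (ENNReal.ofReal p) (surfaceMeasure N) with hM₀
  set M := eLpNorm (sphereGrad φ) (ENNReal.ofReal p) (surfaceMeasure N) with hM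
  have hed : edist σ τ ^ γ = ENNReal.ofReal (dist σ τ ^ γ) := by
    rw [edist_dist, ENNReal.ofReal_rpow_of_nonneg dist_nonneg hγ.le]
  rcases le_or_gt (dist σ τ) (1 / 2) with h | h
  · refine (hC₁ φ hφ σ τ h).trans ?_
    rw [hed]
    gcongr
    · exact le_self_add
    · exact le_add_self
  -- Points more than `1/2` apart: `(2 dist σ τ)^γ ≥ 1`, so the sup bound already implies the Hölder
  -- bound.
  · have hdk : (1 : ℝ≥0∞) ≤ k * edist σ τ ^ γ := by
      rw [hed, ← ENNReal.ofReal_coe_nnreal, ← ENNReal.ofReal_mul (by positivity),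
        ENNReal.one_le_ofReal, NNReal.coe_rpow, ← Real.mul_rpow (by norm_num) dist_nonneg]
      refine Real.one_le_rpow ?_ hγ.le
      rw [NNReal.coe_ofNat]
      linarith
    calc edist (φ σ) (φ τ) ≤ ‖φ σ‖ₑ + ‖φ τ‖ₑ := by
          rw [edist_eq_enorm_sub]; exact enorm_sub_le
      _ ≤ C₂ * (M₀ + M) + C₂ * (M₀ + M) := add_le_add (hC₂ φ hφ σ) (hC₂ φ hφ τ)
      _ = 2 * C₂ * (M₀ + M) * 1 := by ring
      _ ≤ 2 * C₂ * (M₀ + M) * (k * edist σ τ ^ γ) := by gcongr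
      _ = 2 * k * C₂ * (M₀ + M) * edist σ τ ^ γ := by ring
      _ ≤ _ := by
          gcongr
          push_cast
          exact le_add_self

end Morrey

/-! ### Two limit theorems in `L^p`. -/

section LpConvergence

theorem tendsto_eLpNorm_zero_of_dominated {α E F : Type*} [MeasurableSpace α] {μ : Measure α}
    [NormedAddCommGroup E] [NormedAddCommGroup F] {p : ℝ} (hp : 0 < p) {f : ℕ → α → E} {g : α → F}
    (hf : ∀ n, AEStronglyMeasurable (f n) μ) (hg : MemLp g (ENNReal.ofReal p) μ)
    (hfg : ∀ n, ∀ᵐ x ∂μ, ‖f n x‖ ≤ ‖g x‖)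
    (hlim : ∀ᵐ x ∂μ, Tendsto (fun n => f n x) atTop (𝓝 0)) :
    Tendsto (fun n => eLpNorm (f n) (ENNReal.ofReal p) μ) atTop (𝓝 0) := by
  have hp0 : ENNReal.ofReal p ≠ 0 := by simpa using hp
  simp only [eLpNorm_eq_lintegral_rpow_enorm_toReal hp0 ENNReal.ofReal_ne_top,
    ENNReal.toReal_ofReal hp.le]
  have hfin : ∫⁻ x, ‖g x‖ₑ ^ p ∂μ ≠ ∞ := by
    have h := lintegral_rpow_enorm_lt_top_of_eLpNorm_lt_top hp0 ENNReal.ofReal_ne_top hg.2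
    rw [ENNReal.toReal_ofReal hp.le] at h
    exact h.ne
  have h1 : Tendsto (fun n => ∫⁻ x, ‖f n x‖ₑ ^ p ∂μ) atTop (𝓝 (∫⁻ _, 0 ∂μ)) := by
    refine tendsto_lintegral_of_dominated_convergence' (fun x => ‖g x‖ₑ ^ p)
      (fun n => (hf n).enorm.pow_const p) (fun n => ?_) hfin ?_
    · filter_upwards [hfg n] with x hx
      exact ENNReal.rpow_le_rpow (enorm_le_iff_norm_le.mpr hx) hp.le
    · filter_upwards [hlim] with x hx
      have h2 := ((ENNReal.continuous_rpow_const (y := p)).tendsto _).comp hx.enorm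
      simpa [ENNReal.zero_rpow_of_pos hp, Function.comp_def] using h2
  rw [lintegral_zero] at h1
  have h3 := ((ENNReal.continuous_rpow_const (y := 1 / p)).tendsto _).comp h1
  simpa [ENNReal.zero_rpow_of_pos (inv_pos.mpr hp), Function.comp_def] using h3

/-- By Hölder's inequality, pairing with a fixed `L^q` field is continuous on `L^p`; this carries
the weak formulation to limits of test functions. -/
theorem tendsto_integral_inner_of_tendsto_eLpNorm {α F : Type*} [MeasurableSpace α]
    {μ : Measure α} [NormedAddCommGroup F] [InnerProductSpace ℝ F] {p q : ℝ≥0∞}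
    [ENNReal.HolderConjugate p q] {X : α → F} {f : ℕ → α → F} {g : α → F}
    (hX : MemLp X q μ) (hf : ∀ n, MemLp (f n) p μ) (hg : MemLp g p μ)
    (h : Tendsto (fun n => eLpNorm (fun x => f n x - g x) p μ) atTop (𝓝 0)) :
    Tendsto (fun n => ∫ x, inner ℝ (X x) (f n x) ∂μ) atTop (𝓝 (∫ x, inner ℝ (X x) (g x) ∂μ)) := by
  have : ENNReal.HolderTriple q p 1 := inferInstance
  have hb : ∀ u : α → F, ∀ᵐ x ∂μ, ‖inner ℝ (X x) (u x)‖ ≤ (1:ℝ≥0) * ‖X x‖ * ‖u x‖ :=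
    fun u => ae_of_all _ fun x => by simpa using norm_inner_le_norm (𝕜 := ℝ) (X x) (u x)
  refine tendsto_integral_of_L1 _ (hX.1.inner hg.1) (Eventually.of_forall fun n => ?_) ?_
  · rw [← memLp_one_iff_integrable]
    exact MemLp.of_bilin (p := q) (q := p) (r := 1) (fun a b => inner ℝ a b) 1 hX (hf n) (hX.1.inner (hf n).1) (hb _)
  · have h2 : Tendsto (fun n => eLpNorm X q μ * eLpNorm (fun x => f n x - g x) p μ) atTop
        (𝓝 0) := by
      simpa using ENNReal.Tendsto.const_mul h (Or.inr hX.2.ne)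
    refine tendsto_of_tendsto_of_tendsto_of_le_of_le tendsto_const_nhds h2
      (fun n => zero_le) fun n => ?_
    have h3 := eLpNorm_le_eLpNorm_mul_eLpNorm'_of_norm (p := q) (q := p) (r := 1) hX.1 ((hf n).sub hg).1
      (fun a b => inner ℝ a b) 1 (hb _)
    rw [eLpNorm_one_eq_lintegral_enorm] at h3
    simp only [ENNReal.coe_one, one_mul, Pi.sub_apply, inner_sub_right] at h3
    exact h3

end LpConvergence

/-! ### Approximation by smooth functions and the chain rule. -/

section Approximation

variable {N : ℕ} {p : ℝ} {ω : USphere N → ℝ} {G : USphere N → EuclideanSpace ℝ (Fin N)}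
  {φ : ℕ → USphere N → ℝ}

/-- Smooth functions `φ n` converge to `ω` in `L^p` and almost everywhere, and their gradients
converge to `G` in `L^p`. -/
structure SobolevApprox (p : ℝ) (ω : USphere N → ℝ) (G : USphere N → EuclideanSpace ℝ (Fin N))
    (φ : ℕ → USphere N → ℝ) : Prop where
  memLp : MemLp ω (ENNReal.ofReal p) (surfaceMeasure N)
  memLp_grad : MemLp G (ENNReal.ofReal p) (surfaceMeasure N)
  smooth : ∀ n, SphereSmooth (φ n)
  tendsto : Tendsto (fun n => eLpNorm (fun σ => φ n σ - ω σ) (ENNReal.ofReal p)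
      (surfaceMeasure N)) atTop (𝓝 0)
  tendsto_grad : Tendsto (fun n => eLpNorm (fun σ => sphereGrad (φ n) σ - G σ) (ENNReal.ofReal p)
      (surfaceMeasure N)) atTop (𝓝 0)
  ae_tendsto : ∀ᵐ σ ∂(surfaceMeasure N), Tendsto (fun n => φ n σ) atTop (𝓝 (ω σ))

/-- Test functions and their gradients vanish off `S`, so convergence on `S` is convergence on the
sphere for the zero extensions. A subsequence supplies the almost everywhere convergence needed by
the chain rule. -/
theorem HasW0Gradient.exists_sobolevApprox (hp : 0 < p) {S : Set (USphere N)} (hS : IsOpen S)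
    (h : HasW0Gradient p S ω G) :
    ∃ φ : ℕ → USphere N → ℝ, (∀ n, IsTestFunction S (φ n)) ∧
      SobolevApprox p (S.indicator ω) (S.indicator G) φ := by
  obtain ⟨φ, hφ, h1, h2⟩ := h.approx
  have hSm := hS.measurableSet
  have e1 : ∀ n, (fun σ => φ n σ - S.indicator ω σ) = S.indicator (fun σ => φ n σ - ω σ) := by
    intro n
    funext σ
    by_cases hσ : σ ∈ S
    · simp [hσ]
    · have : φ n σ = 0 := image_eq_zero_of_notMem_tsupport fun h' => hσ ((hφ n).2 h')
      simp [hσ, this]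
  have e2 : ∀ n, (fun σ => sphereGrad (φ n) σ - S.indicator G σ) =
      S.indicator (fun σ => sphereGrad (φ n) σ - G σ) := by
    intro n
    funext σ
    by_cases hσ : σ ∈ S
    · simp [hσ]
    · have : sphereGrad (φ n) σ = 0 :=
        sphereGrad_eq_zero_of_notMem_tsupport fun h' => hσ ((hφ n).2 h')
      simp [hσ, this]
  have hm : MemLp (S.indicator ω) (ENNReal.ofReal p) (surfaceMeasure N) :=
    (memLp_indicator_iff_restrict hSm).mpr h.memLp
  have t1 : Tendsto (fun n => eLpNorm (fun σ => φ n σ - S.indicator ω σ) (ENNReal.ofReal p)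
      (surfaceMeasure N)) atTop (𝓝 0) := by
    simp_rw [e1, eLpNorm_indicator_eq_eLpNorm_restrict hSm]; exact h1
  have t2 : Tendsto (fun n => eLpNorm (fun σ => sphereGrad (φ n) σ - S.indicator G σ)
      (ENNReal.ofReal p) (surfaceMeasure N)) atTop (𝓝 0) := by
    simp_rw [e2, eLpNorm_indicator_eq_eLpNorm_restrict hSm]; exact h2
  obtain ⟨ns, hns, hae⟩ := (tendstoInMeasure_of_tendsto_eLpNorm (p := ENNReal.ofReal p)
    (by simpa using hp) (fun n => (hφ n).1.continuous.aestronglyMeasurable) hm.1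
    t1).exists_seq_tendsto_ae
  exact ⟨fun k => φ (ns k), fun k => hφ _, hm, (memLp_indicator_iff_restrict hSm).mpr h.memLp_grad,
    fun k => (hφ _).1, t1.comp hns.tendsto_atTop, t2.comp hns.tendsto_atTop, hae⟩

theorem SphereSmooth.memLp {ψ : USphere N → ℝ} (hψ : SphereSmooth ψ) (q : ℝ≥0∞) :
    MemLp ψ q (surfaceMeasure N) :=
  hψ.continuous.memLp_of_hasCompactSupport (HasCompactSupport.of_compactSpace _)

theorem SphereSmooth.memLp_sphereGrad {ψ : USphere N → ℝ} (hψ : SphereSmooth ψ) (q : ℝ≥0∞) :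
    MemLp (sphereGrad ψ) q (surfaceMeasure N) :=
  hψ.continuous_sphereGrad.memLp_of_hasCompactSupport (HasCompactSupport.of_compactSpace _)

theorem norm_sub_le_of_deriv_le {W : ℝ → ℝ} (hW : Differentiable ℝ W) {L : ℝ}
    (hL : ∀ t, |deriv W t| ≤ L) (a b : ℝ) : ‖W a - W b‖ ≤ L * ‖a - b‖ :=
  Convex.norm_image_sub_le_of_norm_deriv_le (fun x _ => hW x) (fun x _ => hL x) convex_univ
    (Set.mem_univ b) (Set.mem_univ a)

theorem SobolevApprox.comp (hp : 1 ≤ p) (h : SobolevApprox p ω G φ) {W : ℝ → ℝ}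
    (hW : ContDiff ℝ (⊤ : ℕ∞) W) {L : ℝ} (hL : ∀ t, |deriv W t| ≤ L) :
    SobolevApprox p (W ∘ ω) (fun σ => deriv W (ω σ) • G σ) (fun n => W ∘ φ n) := by
  have hp0 : 0 < p := by linarith
  have hWd : Differentiable ℝ W := hW.differentiable (by simp)
  have hW' : Continuous (deriv W) := hW.continuous_deriv (by simp)
  have hLip := norm_sub_le_of_deriv_le hWd hL
  have hL0 : 0 ≤ L := (abs_nonneg _).trans (hL 0)
  have hWm : AEStronglyMeasurable (W ∘ ω) (surfaceMeasure N) :=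
    hW.continuous.comp_aestronglyMeasurable h.memLp.1
  have hW'm : AEStronglyMeasurable (fun σ => deriv W (ω σ)) (surfaceMeasure N) :=
    hW'.comp_aestronglyMeasurable h.memLp.1
  refine ⟨?_, ?_, fun n => (h.smooth n).comp hW, ?_, ?_, ?_⟩
  -- `W 0` need not vanish; the constant is in `L^p` because the sphere has finite measure.
  · have h1 : MemLp (fun σ => W (ω σ) - W 0) (ENNReal.ofReal p) (surfaceMeasure N) := by
      refine MemLp.of_le_mul (c := L) h.memLp (hWm.sub aestronglyMeasurable_const)
        (ae_of_all _ fun σ => ?_)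
      simpa using hLip (ω σ) 0
    have h2 := h1.add (memLp_const (W 0))
    refine h2.ae_eq (ae_of_all _ fun σ => ?_)
    simp
  · refine MemLp.of_le_mul (c := L) h.memLp_grad (hW'm.smul h.memLp_grad.1)
      (ae_of_all _ fun σ => ?_)
    rw [norm_smul]
    gcongr
    exact hL _
  · have hz : Tendsto (fun n => ENNReal.ofReal L * eLpNorm (fun σ => φ n σ - ω σ)
        (ENNReal.ofReal p) (surfaceMeasure N)) atTop (𝓝 0) := by
      simpa using ENNReal.Tendsto.const_mul h.tendsto (Or.inr ENNReal.ofReal_ne_top)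
    refine tendsto_of_tendsto_of_tendsto_of_le_of_le tendsto_const_nhds hz (fun n => zero_le)
      fun n => ?_
    exact eLpNorm_le_mul_eLpNorm_of_ae_le_mul (ae_of_all _ fun σ => hLip (φ n σ) (ω σ)) _
  · have hz : Tendsto (fun n => ENNReal.ofReal L * eLpNorm (fun σ => sphereGrad (φ n) σ - G σ)
        (ENNReal.ofReal p) (surfaceMeasure N)) atTop (𝓝 0) := by
      simpa using ENNReal.Tendsto.const_mul h.tendsto_grad (Or.inr ENNReal.ofReal_ne_top)
    have hm1 : ∀ n, AEStronglyMeasurable (fun σ => deriv W (φ n σ)) (surfaceMeasure N) := fun n =>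
      (hW'.comp (h.smooth n).continuous).aestronglyMeasurable
    have hm2 : ∀ n, AEStronglyMeasurable (fun σ => (deriv W (φ n σ) - deriv W (ω σ)) • G σ)
        (surfaceMeasure N) := fun n => ((hm1 n).sub hW'm).smul h.memLp_grad.1
    have hz2 : Tendsto (fun n => eLpNorm (fun σ => (deriv W (φ n σ) - deriv W (ω σ)) • G σ)
        (ENNReal.ofReal p) (surfaceMeasure N)) atTop (𝓝 0) := by
      refine tendsto_eLpNorm_zero_of_dominated hp0 (g := fun σ => (2 * L) • G σ) hm2
        (h.memLp_grad.const_smul (2 * L)) (fun n => ae_of_all _ fun σ => ?_) ?_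
      · rw [norm_smul, norm_smul]
        gcongr
        rw [Real.norm_of_nonneg (by positivity : 0 ≤ 2 * L), two_mul]
        exact (norm_sub_le _ _).trans (add_le_add (hL _) (hL _))
      · filter_upwards [h.ae_tendsto] with σ hσ
        have h1 : Tendsto (fun n => deriv W (φ n σ) - deriv W (ω σ)) atTop (𝓝 0) := by
          simpa using ((hW'.tendsto _).comp hσ).sub_const (deriv W (ω σ))
        simpa using h1.smul_const (G σ)
    refine tendsto_of_tendsto_of_tendsto_of_le_of_le tendsto_const_nhds
      (by simpa using hz.add hz2) (fun n => zero_le) fun n => ?_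
    -- The first summand is controlled by the bound `L` on `deriv W`; the second tends to zero by
    -- dominated convergence, with majorant `2 L ‖G‖`.
    have e : (fun σ => sphereGrad (W ∘ φ n) σ - deriv W (ω σ) • G σ) =
        (fun σ => deriv W (φ n σ) • (sphereGrad (φ n) σ - G σ)) +
          fun σ => (deriv W (φ n σ) - deriv W (ω σ)) • G σ := by
      funext σ
      rw [(h.smooth n).sphereGrad_comp hWd, Pi.add_apply, smul_sub, sub_smul]
      abel
    rw [e]
    refine (eLpNorm_add_le ((hm1 n).smul
      ((h.smooth n).continuous_sphereGrad.aestronglyMeasurable.sub h.memLp_grad.1)) (hm2 n)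
      (by simpa using hp)).trans ?_
    gcongr
    refine eLpNorm_le_mul_eLpNorm_of_ae_le_mul (ae_of_all _ fun σ => ?_) _
    rw [Pi.smul_apply', norm_smul, Pi.sub_apply]
    gcongr
    exact hL _
  · filter_upwards [h.ae_tendsto] with σ hσ
    exact (hW.continuous.tendsto _).comp hσ

theorem SobolevApprox.tendsto_eLpNorm (hp : 1 ≤ p) (h : SobolevApprox p ω G φ) :
    Tendsto (fun n => eLpNorm (φ n) (ENNReal.ofReal p) (surfaceMeasure N) +
      eLpNorm (sphereGrad (φ n)) (ENNReal.ofReal p) (surfaceMeasure N)) atTop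
      (𝓝 (eLpNorm ω (ENNReal.ofReal p) (surfaceMeasure N) +
        eLpNorm G (ENNReal.ofReal p) (surfaceMeasure N))) := by
  have : Fact (1 ≤ ENNReal.ofReal p) := ⟨by simpa using hp⟩
  have h1 := (Lp.tendsto_Lp_iff_tendsto_eLpNorm'' φ (fun n => (h.smooth n).memLp _) ω
    h.memLp).mpr h.tendsto
  have h2 := (Lp.tendsto_Lp_iff_tendsto_eLpNorm'' (fun n => sphereGrad (φ n))
    (fun n => (h.smooth n).memLp_sphereGrad _) G h.memLp_grad).mpr h.tendsto_grad
  have h3 := h1.enorm.add h2.enorm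
  simpa only [Lp.enorm_toLp] using h3

end Approximation

/-! ### Pointwise inequalities for the degenerate or singular weight. -/

section FluxEstimates

theorem inner_real_eq_mul (a b : ℝ) : inner ℝ a b = a * b := by
  simp [mul_comm]

/-- Used with `x = ‖G‖` and `x = |β ω|`: the flux has growth `p - 1` even when `p < 2`, the singular
weight being compensated by `x ≤ √a`. -/
theorem rpow_mul_le_rpow_of_sq_le {a x p : ℝ} (hx : 0 ≤ x) (h : x ^ 2 ≤ a) :
    a ^ ((p - 2) / 2) * x ≤ a ^ ((p - 1) / 2) := by
  have ha : 0 ≤ a := (sq_nonneg x).trans h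
  rcases ha.eq_or_lt with rfl | ha'
  · have : x = 0 := by nlinarith
    rw [this, mul_zero]
    positivity
  · calc a ^ ((p - 2) / 2) * x ≤ a ^ ((p - 2) / 2) * a ^ ((1:ℝ) / 2) := by
          gcongr
          rw [← Real.sqrt_eq_rpow]
          exact Real.le_sqrt_of_sq_le h
      _ = _ := by rw [← Real.rpow_add ha']; congr 1; ring

theorem rpow_sub_two_half_mul_self {a p : ℝ} (ha : 0 ≤ a) (hp : 0 < p) :
    a ^ ((p - 2) / 2) * a = a ^ (p / 2) := by
  rw [← Real.rpow_add_one' ha (by linarith)]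
  congr 1; ring

theorem sq_rpow_half (w : ℝ) (p : ℝ) : (w ^ 2) ^ (p / 2) = |w| ^ p := by
  rw [← sq_abs, ← Real.rpow_natCast, ← Real.rpow_mul (abs_nonneg w)]
  congr 1
  push_cast; ring

/-- Absorption of the zero-order term of the spherical `p`-harmonic operator. -/
theorem exists_mul_rpow_mul_sq_le {p : ℝ} (hp : 1 < p) {β Λ : ℝ} (hΛ : 0 ≤ Λ)
    (hβ : β = 0 → Λ = 0) :
    ∃ C : ℝ, 0 ≤ C ∧ ∀ w a : ℝ, β ^ 2 * w ^ 2 ≤ a →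
      Λ * (a ^ ((p - 2) / 2) * w ^ 2) ≤ 1 / 2 * a ^ (p / 2) + C * |w| ^ p := by
  have hp0 : 0 < p := by linarith
  have hww : ∀ w : ℝ, (w ^ 2) ^ ((p - 2) / 2) * w ^ 2 = |w| ^ p := fun w => by
    rw [rpow_sub_two_half_mul_self (sq_nonneg w) hp0, sq_rpow_half]
  rcases le_or_gt 2 p with h2 | h2
  -- If `a ≥ k w²`, then `Λ w² ≤ a / 2` and the term is absorbed; otherwise `a < k w²` and the
  -- nonnegative power of `a` is bounded by that of `k w²`.
  · set k := 2 * (Λ + 1) with hk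
    have hk0 : 0 < k := by positivity
    refine ⟨Λ * k ^ ((p - 2) / 2), by positivity, fun w a hwa => ?_⟩
    have ha : 0 ≤ a := le_trans (by positivity) hwa
    rcases le_or_gt (k * w ^ 2) a with h | h
    · have h1 : Λ * w ^ 2 ≤ 1 / 2 * a := by nlinarith [sq_nonneg w]
      calc Λ * (a ^ ((p - 2) / 2) * w ^ 2) = a ^ ((p - 2) / 2) * (Λ * w ^ 2) := by ring
        _ ≤ a ^ ((p - 2) / 2) * (1 / 2 * a) := by gcongr
        _ = 1 / 2 * a ^ (p / 2) := by rw [← rpow_sub_two_half_mul_self ha hp0]; ring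
        _ ≤ _ := le_add_of_nonneg_right (by positivity)
    · calc Λ * (a ^ ((p - 2) / 2) * w ^ 2)
          ≤ Λ * ((k * w ^ 2) ^ ((p - 2) / 2) * w ^ 2) := by
            gcongr
        _ = Λ * k ^ ((p - 2) / 2) * ((w ^ 2) ^ ((p - 2) / 2) * w ^ 2) := by
            rw [Real.mul_rpow hk0.le (sq_nonneg w)]; ring
        _ = Λ * k ^ ((p - 2) / 2) * |w| ^ p := by rw [hww]
        _ ≤ _ := le_add_of_nonneg_left (by positivity)
  -- Now the exponent is negative, so `β² w² ≤ a` bounds the weight from above directly. This needs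
  -- `β ≠ 0`; otherwise `Λ = 0`.
  · refine ⟨Λ * (β ^ 2) ^ ((p - 2) / 2), by positivity, fun w a hwa => ?_⟩
    have ha : 0 ≤ a := le_trans (by positivity) hwa
    refine le_trans ?_ (le_add_of_nonneg_left (by positivity))
    by_cases hβ0 : β = 0
    · simp [hβ hβ0]
    by_cases hw : w = 0
    · simp [hw, Real.zero_rpow hp0.ne']
    calc Λ * (a ^ ((p - 2) / 2) * w ^ 2)
        ≤ Λ * ((β ^ 2 * w ^ 2) ^ ((p - 2) / 2) * w ^ 2) := by
          refine mul_le_mul_of_nonneg_left (mul_le_mul_of_nonneg_right ?_ (sq_nonneg w)) hΛ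
          exact Real.rpow_le_rpow_of_nonpos (by positivity) hwa (by linarith)
      _ = Λ * (β ^ 2) ^ ((p - 2) / 2) * ((w ^ 2) ^ ((p - 2) / 2) * w ^ 2) := by
          rw [Real.mul_rpow (sq_nonneg β) (sq_nonneg w)]; ring
      _ = _ := by rw [hww]

end FluxEstimates

/-! ### Weak formulation and the weighted energy estimate. -/

section WeakSolutions

variable {N : ℕ} {p β : ℝ} {S : Set (USphere N)} {ω : USphere N → ℝ}
  {G : USphere N → EuclideanSpace ℝ (Fin N)}

/-- The weak formulation of the spherical `p`-harmonic eigenvalue problem, for a function and its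
gradient extended by zero outside `S`. -/
def IsWeakSphereSolution (p β : ℝ) (S : Set (USphere N)) (ω : USphere N → ℝ)
    (G : USphere N → EuclideanSpace ℝ (Fin N)) : Prop :=
  ∀ φ : USphere N → ℝ, IsTestFunction S φ →
    ∫ σ, (β ^ 2 * ω σ ^ 2 + ‖G σ‖ ^ 2) ^ ((p - 2) / 2) * inner ℝ (G σ) (sphereGrad φ σ)
        ∂(surfaceMeasure N) =
      (p - 1) * β * (β - betaZero N p) *
        ∫ σ, (β ^ 2 * ω σ ^ 2 + ‖G σ‖ ^ 2) ^ ((p - 2) / 2) * ω σ * φ σ ∂(surfaceMeasure N)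

theorem memLp_sqrt_energy (β : ℝ) {q : ℝ≥0∞} (hω : MemLp ω q (surfaceMeasure N))
    (hG : MemLp G q (surfaceMeasure N)) :
    MemLp (fun σ => √(β ^ 2 * ω σ ^ 2 + ‖G σ‖ ^ 2)) q (surfaceMeasure N) := by
  have hb : MemLp (fun σ => |β| * ‖ω σ‖ + ‖G σ‖) q (surfaceMeasure N) :=
    (hω.norm.const_mul |β|).add hG.norm
  refine hb.mono ?_ (ae_of_all _ fun σ => ?_)
  · exact Real.continuous_sqrt.comp_aestronglyMeasurable
      (((hω.1.pow 2).const_mul _).add (hG.1.norm.pow 2))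
  · rw [Real.norm_of_nonneg (Real.sqrt_nonneg _), Real.norm_of_nonneg (by positivity)]
    refine Real.sqrt_le_iff.mpr ⟨by positivity, ?_⟩
    have h1 : (|β| * ‖ω σ‖) ^ 2 = β ^ 2 * ω σ ^ 2 := by
      rw [mul_pow, sq_abs, Real.norm_eq_abs, sq_abs]
    have h2 : 0 ≤ |β| * ‖ω σ‖ * ‖G σ‖ := by positivity
    nlinarith

theorem sqrt_rpow {a : ℝ} (ha : 0 ≤ a) (s : ℝ) : √a ^ s = a ^ (s / 2) := by
  rw [Real.sqrt_eq_rpow, ← Real.rpow_mul ha]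
  congr 1; ring

theorem memLp_energy_rpow (hp : 1 < p) (β : ℝ)
    (hω : MemLp ω (ENNReal.ofReal p) (surfaceMeasure N))
    (hG : MemLp G (ENNReal.ofReal p) (surfaceMeasure N)) :
    MemLp (fun σ => (β ^ 2 * ω σ ^ 2 + ‖G σ‖ ^ 2) ^ ((p - 1) / 2))
      (ENNReal.ofReal (p / (p - 1))) (surfaceMeasure N) := by
  have hp1 : 0 < p - 1 := by linarith
  have h := (memLp_sqrt_energy β hω hG).norm_rpow_div (ENNReal.ofReal (p - 1))
  rw [← ENNReal.ofReal_div_of_pos hp1, ENNReal.toReal_ofReal hp1.le] at h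
  refine h.ae_eq (ae_of_all _ fun σ => ?_)
  simp only [Real.norm_of_nonneg (Real.sqrt_nonneg _)]
  exact sqrt_rpow (by positivity) _

theorem integrable_energy_rpow (hp : 1 < p) (β : ℝ)
    (hω : MemLp ω (ENNReal.ofReal p) (surfaceMeasure N))
    (hG : MemLp G (ENNReal.ofReal p) (surfaceMeasure N)) :
    Integrable (fun σ => (β ^ 2 * ω σ ^ 2 + ‖G σ‖ ^ 2) ^ (p / 2)) (surfaceMeasure N) := by
  have hp0 : 0 < p := by linarith
  have h := (memLp_sqrt_energy β hω hG).integrable_norm_rpow (by simpa using hp0)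
    ENNReal.ofReal_ne_top
  rw [ENNReal.toReal_ofReal hp0.le] at h
  refine h.congr (ae_of_all _ fun σ => ?_)
  simp only [Real.norm_of_nonneg (Real.sqrt_nonneg _)]
  exact sqrt_rpow (by positivity) _

theorem aestronglyMeasurable_energy_rpow (β s : ℝ)
    (hω : AEStronglyMeasurable ω (surfaceMeasure N))
    (hG : AEStronglyMeasurable G (surfaceMeasure N)) :
    AEStronglyMeasurable (fun σ => (β ^ 2 * ω σ ^ 2 + ‖G σ‖ ^ 2) ^ s) (surfaceMeasure N) :=
  ((((hω.pow 2).const_mul _).add (hG.norm.pow 2)).aemeasurable.pow_const s).aestronglyMeasurable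

/-- The weak formulation extends to limits of test functions. -/
theorem IsWeakSphereSolution.integral_eq (hp : 1 < p) (h : IsWeakSphereSolution p β S ω G)
    (hω : MemLp ω (ENNReal.ofReal p) (surfaceMeasure N))
    (hG : MemLp G (ENNReal.ofReal p) (surfaceMeasure N))
    {ψ : USphere N → ℝ} {H : USphere N → EuclideanSpace ℝ (Fin N)} {χ : ℕ → USphere N → ℝ}
    (hχ : ∀ n, IsTestFunction S (χ n)) (hψ : SobolevApprox p ψ H χ) :
    ∫ σ, (β ^ 2 * ω σ ^ 2 + ‖G σ‖ ^ 2) ^ ((p - 2) / 2) * inner ℝ (G σ) (H σ)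
        ∂(surfaceMeasure N) =
      ∫ σ, (p - 1) * β * (β - betaZero N p) *
        ((β ^ 2 * ω σ ^ 2 + ‖G σ‖ ^ 2) ^ ((p - 2) / 2) * ω σ * ψ σ) ∂(surfaceMeasure N) := by
  set lam := (p - 1) * β * (β - betaZero N p) with hlam
  have hconj : (p).HolderConjugate (p / (p - 1)) := Real.HolderConjugate.conjExponent hp
  have := hconj.ennrealOfReal
  have hBm := aestronglyMeasurable_energy_rpow β ((p - 2) / 2) hω.1 hG.1
  have hE := memLp_energy_rpow hp β hω hG
  -- The flux lies in the dual exponent `p / (p - 1)`, so it pairs with `L^p` limits of gradients.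
  have hX : MemLp (fun σ => (β ^ 2 * ω σ ^ 2 + ‖G σ‖ ^ 2) ^ ((p - 2) / 2) • G σ)
      (ENNReal.ofReal (p / (p - 1))) (surfaceMeasure N) := by
    refine hE.mono (hBm.smul hG.1) (ae_of_all _ fun σ => ?_)
    rw [norm_smul, Real.norm_of_nonneg (by positivity), Real.norm_of_nonneg (by positivity)]
    exact rpow_mul_le_rpow_of_sq_le (norm_nonneg _) (le_add_of_nonneg_left (by positivity))
  have hY : MemLp (fun σ => lam * ((β ^ 2 * ω σ ^ 2 + ‖G σ‖ ^ 2) ^ ((p - 2) / 2) * ω σ))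
      (ENNReal.ofReal (p / (p - 1))) (surfaceMeasure N) := by
    refine hE.of_le_mul (c := |(p - 1) * (β - betaZero N p)|) ((hBm.mul hω.1).const_mul _)
      (ae_of_all _ fun σ => ?_)
    -- One factor `β` of the coefficient is kept with `ω`, because the energy controls `β ω` and not
    -- `ω` alone.
    have e : lam * ((β ^ 2 * ω σ ^ 2 + ‖G σ‖ ^ 2) ^ ((p - 2) / 2) * ω σ) =
        ((p - 1) * (β - betaZero N p)) *
          ((β ^ 2 * ω σ ^ 2 + ‖G σ‖ ^ 2) ^ ((p - 2) / 2) * (β * ω σ)) := by rw [hlam]; ring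
    rw [e, norm_mul, Real.norm_eq_abs]
    gcongr
    have hE0 : ∀ s : ℝ, 0 ≤ (β ^ 2 * ω σ ^ 2 + ‖G σ‖ ^ 2) ^ s := fun s => by positivity
    rw [norm_mul, Real.norm_of_nonneg (hE0 _), Real.norm_of_nonneg (hE0 _)]
    refine rpow_mul_le_rpow_of_sq_le (norm_nonneg _) ?_
    rw [Real.norm_eq_abs, sq_abs, mul_pow]
    exact le_add_of_nonneg_right (by positivity)
  have hL := tendsto_integral_inner_of_tendsto_eLpNorm hX
    (fun n => (hχ n).1.memLp_sphereGrad _) hψ.memLp_grad hψ.tendsto_grad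
  have hR := tendsto_integral_inner_of_tendsto_eLpNorm hY (fun n => (hχ n).1.memLp _)
    hψ.memLp hψ.tendsto
  have heq : ∀ n, ∫ σ, inner ℝ ((β ^ 2 * ω σ ^ 2 + ‖G σ‖ ^ 2) ^ ((p - 2) / 2) • G σ)
      (sphereGrad (χ n) σ) ∂(surfaceMeasure N) =
      ∫ σ, inner ℝ (lam * ((β ^ 2 * ω σ ^ 2 + ‖G σ‖ ^ 2) ^ ((p - 2) / 2) * ω σ)) (χ n σ)
        ∂(surfaceMeasure N) := by
    intro n
    simp only [real_inner_smul_left, inner_real_eq_mul]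
    rw [h (χ n) (hχ n), ← integral_const_mul]
    congr 1
    funext σ
    ring
  have hfin := tendsto_nhds_unique (hL.congr heq) hR
  simp only [real_inner_smul_left, inner_real_eq_mul] at hfin
  rw [hfin]
  congr 1
  funext σ
  ring

/-- Weighted energy estimate: testing the equation with `F ∘ ω`. -/
theorem exists_weighted_energy_le (N : ℕ) {p : ℝ} (hp : 1 < p) (β : ℝ) :
    ∃ C : ℝ≥0, ∀ (S : Set (USphere N)) (ω : USphere N → ℝ)
      (G : USphere N → EuclideanSpace ℝ (Fin N)) (φ : ℕ → USphere N → ℝ),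
      (∀ n, IsTestFunction S (φ n)) → SobolevApprox p ω G φ → IsWeakSphereSolution p β S ω G →
      ∀ (F : ℝ → ℝ) (L : ℝ), ContDiff ℝ (⊤ : ℕ∞) F → F 0 = 0 → (∀ t, 0 ≤ deriv F t) →
        (∀ t, deriv F t ≤ L) → (∀ t, |t * F t| ≤ t ^ 2 * deriv F t) →
        ∫⁻ σ, ‖G σ‖ₑ ^ p * ENNReal.ofReal (deriv F (ω σ)) ∂(surfaceMeasure N) ≤
          C * ∫⁻ σ, ‖ω σ‖ₑ ^ p * ENNReal.ofReal (deriv F (ω σ)) ∂(surfaceMeasure N) := by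
  have hp0 : 0 < p := by linarith
  set lam := (p - 1) * β * (β - betaZero N p) with hlam
  -- The extra `β²` pays for replacing `‖G‖²` by the full energy minus `β² ω²`.
  obtain ⟨C, hC0, hC⟩ := exists_mul_rpow_mul_sq_le hp (β := β) (Λ := |lam| + β ^ 2)
    (by positivity) (fun h => by simp [hlam, h])
  clear_value lam
  refine ⟨(2 * C).toNNReal, fun S ω G φ hφ hω hweak F L hF hF0 hF' hFL hFt => ?_⟩
  have hF'c : Continuous (deriv F) := hF.continuous_deriv (by simp)
  have hFabs : ∀ t, |deriv F t| ≤ L := fun t => by rw [abs_of_nonneg (hF' t)]; exact hFL t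
  have hL0 : 0 ≤ L := (hF' 0).trans (hFL 0)
  -- `F ∘ ω` is admissible as the limit of `F ∘ φ n`, which are test functions since `F 0 = 0`.
  have hid := hweak.integral_eq hp hω.memLp hω.memLp_grad (fun n => (hφ n).comp hF hF0)
    (hω.comp hp.le hF hFabs)
  simp only [real_inner_smul_right, Function.comp_apply, ← hlam] at hid
  set A : USphere N → ℝ := fun σ => β ^ 2 * ω σ ^ 2 + ‖G σ‖ ^ 2 with hA
  set D : USphere N → ℝ := fun σ => deriv F (ω σ) with hD
  have hA0 : ∀ σ, 0 ≤ A σ := fun σ => by positivity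
  have hDm : AEStronglyMeasurable D (surfaceMeasure N) :=
    hF'c.comp_aestronglyMeasurable hω.memLp.1
  have hBm := aestronglyMeasurable_energy_rpow β ((p - 2) / 2) hω.memLp.1 hω.memLp_grad.1
  have hEi := integrable_energy_rpow hp β hω.memLp hω.memLp_grad
  have hωi : Integrable (fun σ => |ω σ| ^ p) (surfaceMeasure N) := by
    have h := hω.memLp.integrable_norm_rpow (by simpa using hp0) ENNReal.ofReal_ne_top
    rwa [ENNReal.toReal_ofReal hp0.le] at h
  have hGi : Integrable (fun σ => ‖G σ‖ ^ p) (surfaceMeasure N) := by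
    have h := hω.memLp_grad.integrable_norm_rpow (by simpa using hp0) ENNReal.ofReal_ne_top
    rwa [ENNReal.toReal_ofReal hp0.le] at h
  have hAB : ∀ σ, A σ ^ ((p - 2) / 2) * ‖G σ‖ ^ 2 =
      A σ ^ (p / 2) - β ^ 2 * (A σ ^ ((p - 2) / 2) * ω σ ^ 2) := by
    intro σ
    rw [← rpow_sub_two_half_mul_self (hA0 σ) hp0]
    simp only [hA]; ring
  have hBω0 : ∀ σ, 0 ≤ A σ ^ ((p - 2) / 2) * ω σ ^ 2 := fun σ => by positivity
  have hyoung : ∀ σ, (|lam| + β ^ 2) * (A σ ^ ((p - 2) / 2) * ω σ ^ 2) ≤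
      1 / 2 * A σ ^ (p / 2) + C * |ω σ| ^ p := fun σ =>
    hC (ω σ) (A σ) (le_add_of_nonneg_right (by positivity))
  have hrhs : ∀ σ, |lam * (A σ ^ ((p - 2) / 2) * ω σ * F (ω σ))| ≤
      |lam| * (A σ ^ ((p - 2) / 2) * ω σ ^ 2) * D σ := by
    intro σ
    have hB := Real.rpow_nonneg (hA0 σ) ((p - 2) / 2)
    calc |lam * (A σ ^ ((p - 2) / 2) * ω σ * F (ω σ))|
        = |lam| * (A σ ^ ((p - 2) / 2) * |ω σ * F (ω σ)|) := by
          rw [mul_assoc, abs_mul, abs_mul, abs_of_nonneg hB]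
      _ ≤ |lam| * (A σ ^ ((p - 2) / 2) * (ω σ ^ 2 * D σ)) :=
          mul_le_mul_of_nonneg_left (mul_le_mul_of_nonneg_left (hFt _) hB) (abs_nonneg _)
      _ = _ := by ring
  have hi1 : Integrable (fun σ => A σ ^ ((p - 2) / 2) * (D σ * inner ℝ (G σ) (G σ)))
      (surfaceMeasure N) := by
    refine (hEi.const_mul L).mono' (hBm.mul (hDm.mul (hω.memLp_grad.1.inner hω.memLp_grad.1)))
      (ae_of_all _ fun σ => ?_)
    have e : A σ ^ ((p - 2) / 2) * (D σ * inner ℝ (G σ) (G σ)) =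
        D σ * (A σ ^ ((p - 2) / 2) * ‖G σ‖ ^ 2) := by
      rw [real_inner_self_eq_norm_sq]; ring
    have h0 : 0 ≤ A σ ^ ((p - 2) / 2) * ‖G σ‖ ^ 2 :=
      mul_nonneg (Real.rpow_nonneg (hA0 σ) _) (sq_nonneg _)
    rw [e, Real.norm_of_nonneg (mul_nonneg (hF' _) h0)]
    refine mul_le_mul (hFL _) ?_ h0 hL0
    rw [hAB]
    have := hBω0 σ
    nlinarith [sq_nonneg β]
  have hi2 : Integrable (fun σ => lam * (A σ ^ ((p - 2) / 2) * ω σ * F (ω σ)))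
      (surfaceMeasure N) := by
    refine (((hEi.const_mul (1 / 2)).add (hωi.const_mul C)).const_mul L).mono'
      (((hBm.mul hω.memLp.1).mul
        (hF.continuous.comp_aestronglyMeasurable hω.memLp.1)).const_mul _)
      (ae_of_all _ fun σ => (hrhs σ).trans ?_)
    rw [mul_comm]
    refine mul_le_mul (hFL _) (le_trans ?_ (hyoung σ))
      (mul_nonneg (abs_nonneg _) (hBω0 σ)) hL0
    have := hBω0 σ
    nlinarith [sq_nonneg β]
  have hi3 : Integrable (fun σ => |ω σ| ^ p * D σ) (surfaceMeasure N) := by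
    have h := hωi.mul_bdd (c := L) hDm (ae_of_all _ fun σ => hFabs _)
    exact h
  have hi4 : Integrable (fun σ => ‖G σ‖ ^ p * D σ) (surfaceMeasure N) := by
    have h := hGi.mul_bdd (c := L) hDm (ae_of_all _ fun σ => hFabs _)
    exact h
  -- After absorption half of `A^(p/2)` is left, whence the factor `2`. On integration the first two
  -- terms on the right cancel, by the equation `hid`.
  have hpt : ∀ σ, ‖G σ‖ ^ p * D σ ≤
      2 * (A σ ^ ((p - 2) / 2) * (D σ * inner ℝ (G σ) (G σ)) -
        lam * (A σ ^ ((p - 2) / 2) * ω σ * F (ω σ)) + C * (|ω σ| ^ p * D σ)) := by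
    intro σ
    have h1 : ‖G σ‖ ^ p ≤ A σ ^ (p / 2) := by
      have := sq_rpow_half ‖G σ‖ p
      rw [abs_of_nonneg (norm_nonneg _)] at this
      rw [← this]
      exact Real.rpow_le_rpow (sq_nonneg _) (le_add_of_nonneg_left (by positivity)) (by positivity)
    have h2 := (abs_le.mp (hrhs σ)).2
    have h3 : A σ ^ ((p - 2) / 2) * (D σ * inner ℝ (G σ) (G σ)) =
        D σ * (A σ ^ (p / 2) - β ^ 2 * (A σ ^ ((p - 2) / 2) * ω σ ^ 2)) := by
      rw [← hAB, real_inner_self_eq_norm_sq]; ring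
    have h4 := mul_le_mul_of_nonneg_left (hyoung σ) (hF' (ω σ))
    have h5 := mul_le_mul_of_nonneg_left h1 (hF' (ω σ))
    rw [h3]
    change D σ * _ ≤ D σ * _ at h4
    change D σ * _ ≤ D σ * _ at h5
    nlinarith
  have hint : ∫ σ, ‖G σ‖ ^ p * D σ ∂(surfaceMeasure N) ≤
      2 * C * ∫ σ, |ω σ| ^ p * D σ ∂(surfaceMeasure N) := by
    have h12 : Integrable (fun σ => A σ ^ ((p - 2) / 2) * (D σ * inner ℝ (G σ) (G σ)) -
        lam * (A σ ^ ((p - 2) / 2) * ω σ * F (ω σ))) (surfaceMeasure N) := hi1.sub hi2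
    have h13 : Integrable (fun σ => A σ ^ ((p - 2) / 2) * (D σ * inner ℝ (G σ) (G σ)) -
        lam * (A σ ^ ((p - 2) / 2) * ω σ * F (ω σ)) + C * (|ω σ| ^ p * D σ)) (surfaceMeasure N) :=
      h12.add (hi3.const_mul C)
    refine (integral_mono hi4 (h13.const_mul 2) hpt).trans (le_of_eq ?_)
    rw [integral_const_mul, integral_add h12 (hi3.const_mul C), integral_sub hi1 hi2,
      integral_const_mul C, hid]
    ring
  have c1 : ∀ σ, ‖G σ‖ₑ ^ p * ENNReal.ofReal (D σ) = ENNReal.ofReal (‖G σ‖ ^ p * D σ) := by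
    intro σ
    rw [ENNReal.ofReal_mul (by positivity), ← ENNReal.ofReal_rpow_of_nonneg (norm_nonneg _) hp0.le,
      ofReal_norm]
  have c2 : ∀ σ, ‖ω σ‖ₑ ^ p * ENNReal.ofReal (D σ) = ENNReal.ofReal (|ω σ| ^ p * D σ) := by
    intro σ
    rw [ENNReal.ofReal_mul (by positivity), ← ENNReal.ofReal_rpow_of_nonneg (abs_nonneg _) hp0.le,
      ← Real.norm_eq_abs, ofReal_norm]
  rw [lintegral_congr c1, lintegral_congr c2, ← ofReal_integral_eq_lintegral_ofReal hi4 (ae_of_all _ fun σ =>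
      mul_nonneg (by positivity) (hF' _)),
    ← ofReal_integral_eq_lintegral_ofReal hi3 (ae_of_all _ fun σ =>
      mul_nonneg (by positivity) (hF' _))]
  change _ ≤ ENNReal.ofReal (2 * C) * _
  rw [← ENNReal.ofReal_mul (by positivity)]
  exact ENNReal.ofReal_le_ofReal hint

end WeakSolutions

/-! ### Smooth bounded truncations of powers. -/

section Truncation

/-- A smooth bounded truncation of `ε + t ^ 2`. -/
noncomputable def truncSq (ε δ t : ℝ) : ℝ := ε + t ^ 2 / (1 + δ * t ^ 2)

variable {ε δ : ℝ}

theorem le_truncSq (hδ : 0 < δ) (t : ℝ) : ε ≤ truncSq ε δ t :=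
  le_add_of_nonneg_right (by positivity)

theorem truncSq_pos (hε : 0 < ε) (hδ : 0 < δ) (t : ℝ) : 0 < truncSq ε δ t :=
  hε.trans_le (le_truncSq hδ t)

theorem truncSq_le (hδ : 0 < δ) (t : ℝ) : truncSq ε δ t ≤ ε + t ^ 2 := by
  unfold truncSq
  gcongr
  exact div_le_self (sq_nonneg t) (le_add_of_nonneg_right (by positivity))

theorem truncSq_le_bound (hδ : 0 < δ) (t : ℝ) : truncSq ε δ t ≤ ε + 1 / δ := by
  unfold truncSq
  gcongr ε + ?_
  rw [div_le_div_iff₀ (by positivity) hδ]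
  nlinarith

theorem truncSq_mono (hδ : 0 < δ) {x t : ℝ} (h : |x| ≤ |t|) : truncSq ε δ x ≤ truncSq ε δ t := by
  unfold truncSq
  have h2 : x ^ 2 ≤ t ^ 2 := sq_le_sq.mpr h
  gcongr ε + ?_
  rw [div_le_div_iff₀ (by positivity) (by positivity)]
  nlinarith

theorem contDiff_truncSq (hδ : 0 < δ) : ContDiff ℝ (⊤ : ℕ∞) (truncSq ε δ) := by
  unfold truncSq
  refine contDiff_const.add (ContDiff.div (by fun_prop) (by fun_prop) fun t => ?_)
  positivity

theorem contDiff_truncSq_rpow (hε : 0 < ε) (hδ : 0 < δ) (r : ℝ) :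
    ContDiff ℝ (⊤ : ℕ∞) fun t => truncSq ε δ t ^ r :=
  (contDiff_truncSq hδ).rpow_const_of_ne fun t => (truncSq_pos hε hδ t).ne'

theorem hasDerivAt_truncSq (hδ : 0 < δ) (t : ℝ) :
    HasDerivAt (truncSq ε δ) (2 * t / (1 + δ * t ^ 2) ^ 2) t := by
  have h1 : HasDerivAt (fun t : ℝ => t ^ 2) (2 * t) t := by simpa using hasDerivAt_pow 2 t
  have h2 : (1 + δ * t ^ 2) ≠ 0 := by positivity
  have h3 := (h1.div ((h1.const_mul δ).const_add 1) h2).const_add ε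
  refine h3.congr_deriv ?_
  congr 1
  ring

theorem abs_deriv_truncSq_le (hε : 0 < ε) (hδ : 0 < δ) (t : ℝ) :
    |2 * t / (1 + δ * t ^ 2) ^ 2| ≤ 2 * truncSq ε δ t ^ ((1:ℝ) / 2) := by
  rw [← Real.sqrt_eq_rpow, mul_div_assoc, abs_mul, abs_two]
  gcongr
  refine Real.le_sqrt_of_sq_le ?_
  rw [sq_abs, div_pow]
  have hk : 1 ≤ 1 + δ * t ^ 2 := le_add_of_nonneg_right (by positivity)
  calc t ^ 2 / ((1 + δ * t ^ 2) ^ 2) ^ 2 ≤ t ^ 2 / (1 + δ * t ^ 2) := by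
        gcongr
        rw [← pow_mul]
        exact le_self_pow₀ hk (by norm_num)
    _ ≤ _ := le_add_of_nonneg_left hε.le

/-- Differentiation costs half a power of the truncation and a factor `s`, uniformly in `ε` and `δ`;
the uniformity permits `δ → 0`. -/
theorem abs_deriv_truncSq_rpow_le (hε : 0 < ε) (hδ : 0 < δ) {s : ℝ} (hs : 0 ≤ s) (t : ℝ) :
    |deriv (fun t => truncSq ε δ t ^ (s / 2)) t| ≤ s * truncSq ε δ t ^ ((s - 1) / 2) := by
  have hpos := truncSq_pos hε hδ t
  have h := (hasDerivAt_truncSq (ε := ε) hδ t).rpow_const (p := s / 2) (Or.inl hpos.ne')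
  rw [h.deriv, abs_mul, abs_mul, abs_of_nonneg (by positivity : 0 ≤ s / 2),
    abs_of_nonneg (Real.rpow_nonneg hpos.le _)]
  calc |2 * t / (1 + δ * t ^ 2) ^ 2| * (s / 2) * truncSq ε δ t ^ (s / 2 - 1)
      ≤ 2 * truncSq ε δ t ^ ((1:ℝ) / 2) * (s / 2) * truncSq ε δ t ^ (s / 2 - 1) := by
        gcongr
        exact abs_deriv_truncSq_le hε hδ t
    _ = s * (truncSq ε δ t ^ ((1:ℝ) / 2) * truncSq ε δ t ^ (s / 2 - 1)) := by ring
    _ = _ := by rw [← Real.rpow_add hpos]; congr 2; ring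

/-- The odd primitive of a power of the truncation. -/
noncomputable def truncPrimitive (ε δ r t : ℝ) : ℝ := ∫ x in (0:ℝ)..t, truncSq ε δ x ^ r

theorem deriv_truncPrimitive (hε : 0 < ε) (hδ : 0 < δ) (r : ℝ) :
    deriv (truncPrimitive ε δ r) = fun t => truncSq ε δ t ^ r :=
  funext fun t => (contDiff_truncSq_rpow hε hδ r).continuous.deriv_integral _ 0 t

theorem contDiff_truncPrimitive (hε : 0 < ε) (hδ : 0 < δ) (r : ℝ) :
    ContDiff ℝ (⊤ : ℕ∞) (truncPrimitive ε δ r) := by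
  refine contDiff_infty_iff_deriv.mpr ⟨fun t => ?_, ?_⟩
  · exact intervalIntegral.differentiable_integral_of_continuous
      (contDiff_truncSq_rpow hε hδ r).continuous t
  · rw [deriv_truncPrimitive hε hδ]
    exact contDiff_truncSq_rpow hε hδ r

/-- The integrand is nondecreasing in `|x|`, so the primitive is at most `|t|` times its value at
`t`. This is the condition on test nonlinearities in the energy estimate. -/
theorem abs_mul_truncPrimitive_le (hε : 0 < ε) (hδ : 0 < δ) {r : ℝ} (hr : 0 ≤ r) (t : ℝ) :
    |t * truncPrimitive ε δ r t| ≤ t ^ 2 * truncSq ε δ t ^ r := by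
  have h : ‖truncPrimitive ε δ r t‖ ≤ truncSq ε δ t ^ r * |t - 0| := by
    refine intervalIntegral.norm_integral_le_of_norm_le_const fun x hx => ?_
    rw [Real.norm_of_nonneg (Real.rpow_nonneg (truncSq_pos hε hδ x).le _)]
    refine Real.rpow_le_rpow (truncSq_pos hε hδ x).le (truncSq_mono hδ ?_) hr
    rcases le_total 0 t with h0 | h0
    · rw [Set.uIoc_of_le h0] at hx
      rw [abs_of_pos hx.1, abs_of_nonneg h0]; exact hx.2
    · rw [Set.uIoc_of_ge h0] at hx
      rw [abs_of_nonpos hx.2, abs_of_nonpos h0]; linarith [hx.1]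
  rw [sub_zero, Real.norm_eq_abs] at h
  rw [abs_mul, ← sq_abs t]
  calc |t| * |truncPrimitive ε δ r t| ≤ |t| * (truncSq ε δ t ^ r * |t|) := by gcongr
    _ = _ := by ring

theorem tendsto_truncSq (ε t : ℝ) :
    Tendsto (fun n : ℕ => truncSq ε (1 / ((n:ℝ) + 1)) t) atTop (𝓝 (ε + t ^ 2)) := by
  have h1 : Tendsto (fun n : ℕ => 1 + 1 / ((n:ℝ) + 1) * t ^ 2) atTop (𝓝 (1 + 0 * t ^ 2)) :=
    (tendsto_one_div_add_atTop_nhds_zero_nat.mul_const _).const_add 1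
  have h2 := ((tendsto_const_nhds (x := t ^ 2)).div h1 (by norm_num)).const_add ε
  simpa [truncSq] using h2

end Truncation

/-! ### Abstract Moser iteration. -/

section Iteration

/-- By Chebyshev's inequality, for `b' > K` the set where `|v| ≥ b'` has measure at most `(K /
b')^(q k)`, which tends to zero. -/
theorem eLpNorm_top_le_of_forall_le {α : Type*} [MeasurableSpace α] {μ : Measure α} {v : α → ℝ}
    (hv : AEStronglyMeasurable v μ) {q : ℕ → ℝ} (hq0 : ∀ k, 0 < q k) (hq : Tendsto q atTop atTop)
    {K : ℝ≥0∞} (h : ∀ k, eLpNorm v (ENNReal.ofReal (q k)) μ ≤ K) : eLpNorm v ∞ μ ≤ K := by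
  refine le_of_forall_gt fun b hb => lt_of_not_ge fun hbe => ?_
  obtain ⟨b', hKb', hb'b⟩ := exists_between hb
  have hb'0 : b' ≠ 0 := (pos_of_gt hKb').ne'
  have hb't : b' ≠ ∞ := (hb'b.trans_le le_top).ne
  have h1 : ∀ k, μ {x | b' ≤ ‖v x‖ₑ} ≤ (K / b') ^ q k := by
    intro k
    have h2 := mul_meas_ge_le_pow_eLpNorm' μ (p := ENNReal.ofReal (q k))
      (by simpa using hq0 k) ENNReal.ofReal_ne_top hv b'
    rw [ENNReal.toReal_ofReal (hq0 k).le] at h2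
    rw [ENNReal.div_rpow_of_nonneg _ _ (hq0 k).le, ENNReal.le_div_iff_mul_le
      (Or.inl (by simp [ENNReal.rpow_eq_zero_iff, hb'0, hb't]))
      (Or.inl (ENNReal.rpow_ne_top_of_nonneg (hq0 k).le hb't)), mul_comm]
    exact h2.trans (ENNReal.rpow_le_rpow (h k) (hq0 k).le)
  have hlt : K / b' < 1 := ENNReal.div_lt_of_lt_mul (by rwa [one_mul])
  have h3 := (ENNReal.tendsto_rpow_atTop_of_base_lt_one hlt).comp hq
  have h4 : μ {x | b' ≤ ‖v x‖ₑ} = 0 := le_antisymm (ge_of_tendsto' h3 h1) zero_le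
  have h5 : eLpNorm v ∞ μ ≤ b' := by
    rw [eLpNorm_exponent_top]
    refine essSup_le_of_ae_le _ ?_
    have : ∀ᵐ x ∂μ, ¬ b' ≤ ‖v x‖ₑ := by
      rw [ae_iff]; simpa using h4
    filter_upwards [this] with x hx
    exact (not_le.mp hx).le
  exact absurd (hbe.trans h5) (not_le.mpr hb'b)

/-- **Moser iteration**: a uniform gain of integrability for all powers gives a bound. -/
theorem exists_moser_iteration {χ : ℝ} (hχ : 1 < χ) (C : ℝ≥0) :
    ∃ P : ℝ≥0, ∀ {α : Type*} [MeasurableSpace α] (μ : Measure α) (v : α → ℝ) (p : ℝ), 0 < p →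
      AEStronglyMeasurable v μ →
      (∀ s : ℝ, 1 ≤ s → eLpNorm v (ENNReal.ofReal (p * χ * s)) μ ≤
        (C * ENNReal.ofReal s) ^ (1 / s) * eLpNorm v (ENNReal.ofReal (p * s)) μ) →
      eLpNorm v ∞ μ ≤ P * eLpNorm v (ENNReal.ofReal p) μ := by
  have hχ0 : 0 < χ := by linarith
  set D : ℝ := max C 1 with hD
  have hD1 : 1 ≤ D := le_max_right _ _
  have hD0 : 0 < D := by linarith
  -- `e i` is the logarithm of the factor `(D χ^i)^(1/χ^i)` lost at step `i`, where `s = χ^i`. These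
  -- are summable, and nonnegative because `D ≥ 1`.
  set e : ℕ → ℝ := fun i => (χ⁻¹) ^ i * (Real.log D + i * Real.log χ) with he
  have he0 : ∀ i, 0 ≤ e i := fun i => by
    have := Real.log_nonneg hD1
    have := Real.log_nonneg hχ.le
    positivity
  have hr : ‖χ⁻¹‖ < 1 := by
    rw [Real.norm_of_nonneg (by positivity)]; exact inv_lt_one_of_one_lt₀ hχ
  have hsum : Summable e := by
    have h1 := (summable_geometric_of_norm_lt_one hr).mul_right (Real.log D)
    have h2 := (summable_pow_mul_geometric_of_norm_lt_one 1 hr).mul_right (Real.log χ)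
    refine (h1.add h2).congr fun i => ?_
    simp only [he, pow_one]; ring
  refine ⟨(Real.exp (∑' i, e i)).toNNReal, fun μ v p hp hv hstep => ?_⟩
  have hfac : ∀ k : ℕ, (C * ENNReal.ofReal (χ ^ k)) ^ (1 / χ ^ k) ≤
      ENNReal.ofReal (Real.exp (e k)) := by
    intro k
    have hk : 0 < χ ^ k := by positivity
    have h1 : (C : ℝ≥0∞) * ENNReal.ofReal (χ ^ k) ≤ ENNReal.ofReal (D * χ ^ k) := by
      rw [ENNReal.ofReal_mul hD0.le]
      gcongr
      rw [← ENNReal.ofReal_coe_nnreal]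
      exact ENNReal.ofReal_le_ofReal (le_max_left _ _)
    refine (ENNReal.rpow_le_rpow h1 (by positivity)).trans (le_of_eq ?_)
    rw [ENNReal.ofReal_rpow_of_pos (by positivity), Real.rpow_def_of_pos (by positivity),
      Real.log_mul hD0.ne' hk.ne', Real.log_pow]
    congr 2
    simp only [he]
    rw [inv_pow]
    ring
  have hiter : ∀ k : ℕ, eLpNorm v (ENNReal.ofReal (p * χ ^ k)) μ ≤
      ENNReal.ofReal (Real.exp (∑ i ∈ Finset.range k, e i)) * eLpNorm v (ENNReal.ofReal p) μ := by
    intro k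
    induction k with
    | zero => simp
    | succ k ih =>
      have h1 := hstep (χ ^ k) (one_le_pow₀ hχ.le)
      rw [show p * χ ^ (k + 1) = p * χ * χ ^ k by ring]
      calc _ ≤ _ := h1
        _ ≤ ENNReal.ofReal (Real.exp (e k)) * (ENNReal.ofReal (Real.exp (∑ i ∈ Finset.range k, e i))
              * eLpNorm v (ENNReal.ofReal p) μ) := by gcongr; exact hfac k
        _ = _ := by
          rw [← mul_assoc, ← ENNReal.ofReal_mul (Real.exp_pos _).le, ← Real.exp_add,
            Finset.sum_range_succ, add_comm]
  refine eLpNorm_top_le_of_forall_le hv (q := fun k => p * χ ^ k) (fun k => by positivity)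
    ((tendsto_pow_atTop_atTop_of_one_lt hχ).const_mul_atTop hp) fun k => (hiter k).trans ?_
  change _ ≤ ENNReal.ofReal _ * _
  gcongr
  exact hsum.sum_le_tsum _ fun i _ => he0 i

end Iteration

/-! ### Gain of integrability at each power. -/

section MoserStep

variable {N : ℕ} {p : ℝ} {ω : USphere N → ℝ} {G : USphere N → EuclideanSpace ℝ (Fin N)}
  {φ : ℕ → USphere N → ℝ}

/-- Fatou's lemma along the almost everywhere convergent sequence; no prior integrability of `ω` at
exponent `q` is needed. -/
theorem SobolevApprox.eLpNorm_le (hp : 1 ≤ p) (h : SobolevApprox p ω G φ) {q : ℝ≥0∞} {C : ℝ≥0}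
    (hC : ∀ φ : USphere N → ℝ, SphereSmooth φ → eLpNorm φ q (surfaceMeasure N) ≤
        C * (eLpNorm φ (ENNReal.ofReal p) (surfaceMeasure N) +
          eLpNorm (sphereGrad φ) (ENNReal.ofReal p) (surfaceMeasure N))) :
    eLpNorm ω q (surfaceMeasure N) ≤ C * (eLpNorm ω (ENNReal.ofReal p) (surfaceMeasure N) +
      eLpNorm G (ENNReal.ofReal p) (surfaceMeasure N)) := by
  have h1 := ENNReal.Tendsto.const_mul (h.tendsto_eLpNorm hp)
    (Or.inr (ENNReal.coe_ne_top (r := C)))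
  refine (Lp.eLpNorm_lim_le_liminf_eLpNorm
    (fun n => (h.smooth n).continuous.aestronglyMeasurable) ω h.ae_tendsto).trans ?_
  rw [← h1.liminf_eq]
  exact liminf_le_liminf (Eventually.of_forall fun n => hC _ (h.smooth n))

/-- One step of the Moser iteration, for a truncated power. -/
theorem eLpNorm_truncSq_rpow_le (hp : 1 < p) (h : SobolevApprox p ω G φ) {q : ℝ≥0∞} {C₁ C₂ : ℝ≥0}
    (hC₁ : ∀ φ : USphere N → ℝ, SphereSmooth φ → eLpNorm φ q (surfaceMeasure N) ≤
        C₁ * (eLpNorm φ (ENNReal.ofReal p) (surfaceMeasure N) +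
          eLpNorm (sphereGrad φ) (ENNReal.ofReal p) (surfaceMeasure N)))
    (hC₂ : ∀ (F : ℝ → ℝ) (L : ℝ), ContDiff ℝ (⊤ : ℕ∞) F → F 0 = 0 → (∀ t, 0 ≤ deriv F t) →
        (∀ t, deriv F t ≤ L) → (∀ t, |t * F t| ≤ t ^ 2 * deriv F t) →
        ∫⁻ σ, ‖G σ‖ₑ ^ p * ENNReal.ofReal (deriv F (ω σ)) ∂(surfaceMeasure N) ≤
          C₂ * ∫⁻ σ, ‖ω σ‖ₑ ^ p * ENNReal.ofReal (deriv F (ω σ)) ∂(surfaceMeasure N))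
    {ε δ s : ℝ} (hε : 0 < ε) (hδ : 0 < δ) (hs : 1 ≤ s) :
    eLpNorm (fun σ => truncSq ε δ (ω σ) ^ (s / 2)) q (surfaceMeasure N) ≤
      C₁ * (1 + C₂ ^ (1 / p)) * ENNReal.ofReal s *
        eLpNorm (fun σ => (ε + ω σ ^ 2) ^ (s / 2)) (ENNReal.ofReal p) (surfaceMeasure N) := by
  have hp0 : 0 < p := by linarith
  have hs0 : 0 < s := by linarith
  have hp0' : ENNReal.ofReal p ≠ 0 := by simpa using hp0
  set W : ℝ → ℝ := fun t => truncSq ε δ t ^ (s / 2) with hW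
  have hWs : ContDiff ℝ (⊤ : ℕ∞) W := contDiff_truncSq_rpow hε hδ _
  have hWd := abs_deriv_truncSq_rpow_le hε hδ hs0.le
  have hWb : ∀ t, |deriv W t| ≤ s * (ε + 1 / δ) ^ ((s - 1) / 2) := fun t =>
    (hWd t).trans (mul_le_mul_of_nonneg_left (Real.rpow_le_rpow (truncSq_pos hε hδ t).le
      (truncSq_le_bound hδ t) (by linarith)) hs0.le)
  have h1 := (h.comp hp.le hWs hWb).eLpNorm_le hp.le hC₁
  -- Chosen so that `truncSq ^ r` is the `p`-th power of `truncSq ^ ((s - 1) / 2)`, the weight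
  -- produced by differentiating `W`. Moreover `p / 2 + r = p s / 2`, which closes the estimate in
  -- terms of `Y`.
  set r := (s - 1) * p / 2 with hr
  have hr0 : 0 ≤ r := by rw [hr]; have : 0 ≤ s - 1 := by linarith
                         positivity
  have hE := hC₂ (truncPrimitive ε δ r) ((ε + 1 / δ) ^ r) (contDiff_truncPrimitive hε hδ r)
    (by simp [truncPrimitive])
    (fun t => by
      rw [deriv_truncPrimitive hε hδ]; exact Real.rpow_nonneg (truncSq_pos hε hδ t).le _)
    (fun t => by
      rw [deriv_truncPrimitive hε hδ]
      exact Real.rpow_le_rpow (truncSq_pos hε hδ t).le (truncSq_le_bound hδ t) hr0)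
    (fun t => by
      rw [deriv_truncPrimitive hε hδ]; exact abs_mul_truncPrimitive_le hε hδ hr0 t)
  simp only [deriv_truncPrimitive hε hδ] at hE
  set Y := eLpNorm (fun σ => (ε + ω σ ^ 2) ^ (s / 2)) (ENNReal.ofReal p) (surfaceMeasure N)
    with hY
  have hWY : eLpNorm (W ∘ ω) (ENNReal.ofReal p) (surfaceMeasure N) ≤ Y := by
    refine eLpNorm_mono fun σ => ?_
    rw [Function.comp_apply, Real.norm_of_nonneg (Real.rpow_nonneg (truncSq_pos hε hδ _).le _),
      Real.norm_of_nonneg (by positivity)]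
    exact Real.rpow_le_rpow (truncSq_pos hε hδ _).le (truncSq_le hδ _) (by positivity)
  have hYint : ∫⁻ σ, ‖ω σ‖ₑ ^ p * ENNReal.ofReal (truncSq ε δ (ω σ) ^ r) ∂(surfaceMeasure N) ≤
      Y ^ p := by
    rw [hY, eLpNorm_eq_lintegral_rpow_enorm_toReal hp0' ENNReal.ofReal_ne_top,
      ENNReal.toReal_ofReal hp0.le, ← ENNReal.rpow_mul, one_div_mul_cancel hp0.ne',
      ENNReal.rpow_one]
    refine lintegral_mono fun σ => ?_
    have hv0 : 0 < ε + ω σ ^ 2 := by positivity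
    have e1 : ‖ω σ‖ₑ ^ p = ENNReal.ofReal ((ω σ ^ 2) ^ (p / 2)) := by
      rw [sq_rpow_half, ← ENNReal.ofReal_rpow_of_nonneg (abs_nonneg _) hp0.le, ← Real.norm_eq_abs,
        ofReal_norm]
    have e2 : ‖(ε + ω σ ^ 2) ^ (s / 2)‖ₑ ^ p =
        ENNReal.ofReal ((ε + ω σ ^ 2) ^ (p / 2) * (ε + ω σ ^ 2) ^ r) := by
      rw [Real.enorm_of_nonneg (by positivity), ENNReal.ofReal_rpow_of_nonneg (by positivity)
        hp0.le, ← Real.rpow_mul hv0.le, ← Real.rpow_add hv0]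
      congr 2
      rw [hr]; ring
    rw [e1, e2, ← ENNReal.ofReal_mul (by positivity)]
    refine ENNReal.ofReal_le_ofReal (mul_le_mul ?_ ?_
      (Real.rpow_nonneg (truncSq_pos hε hδ _).le _) (by positivity))
    · exact Real.rpow_le_rpow (sq_nonneg _) (le_add_of_nonneg_left hε.le) (by positivity)
    · exact Real.rpow_le_rpow (truncSq_pos hε hδ _).le (truncSq_le hδ _) hr0
  have hGY : eLpNorm (fun σ => deriv W (ω σ) • G σ) (ENNReal.ofReal p) (surfaceMeasure N) ≤
      ENNReal.ofReal s * C₂ ^ (1 / p) * Y := by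
    rw [eLpNorm_eq_lintegral_rpow_enorm_toReal hp0' ENNReal.ofReal_ne_top,
      ENNReal.toReal_ofReal hp0.le]
    have h2 : ∫⁻ σ, ‖deriv W (ω σ) • G σ‖ₑ ^ p ∂(surfaceMeasure N) ≤
        ENNReal.ofReal s ^ p * (C₂ * Y ^ p) := by
      calc ∫⁻ σ, ‖deriv W (ω σ) • G σ‖ₑ ^ p ∂(surfaceMeasure N)
          ≤ ∫⁻ σ, ENNReal.ofReal s ^ p * (‖G σ‖ₑ ^ p *
              ENNReal.ofReal (truncSq ε δ (ω σ) ^ r)) ∂(surfaceMeasure N) := by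
            refine lintegral_mono fun σ => ?_
            have hpos := truncSq_pos hε hδ (ω σ)
            rw [enorm_smul, ENNReal.mul_rpow_of_nonneg _ _ hp0.le, mul_comm (‖G σ‖ₑ ^ p),
              ← mul_assoc]
            gcongr
            have e3 : ENNReal.ofReal s ^ p * ENNReal.ofReal (truncSq ε δ (ω σ) ^ r) =
                ENNReal.ofReal (s * truncSq ε δ (ω σ) ^ ((s - 1) / 2)) ^ p := by
              rw [ENNReal.ofReal_mul hs0.le, ENNReal.mul_rpow_of_nonneg _ _ hp0.le,
                ENNReal.ofReal_rpow_of_nonneg (Real.rpow_nonneg hpos.le ((s - 1) / 2)) hp0.le,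
                ← Real.rpow_mul hpos.le, hr]
              congr 3
              ring
            rw [e3]
            refine ENNReal.rpow_le_rpow ?_ hp0.le
            rw [← ofReal_norm]
            exact ENNReal.ofReal_le_ofReal (hWd _)
        _ = ENNReal.ofReal s ^ p * ∫⁻ σ, ‖G σ‖ₑ ^ p *
              ENNReal.ofReal (truncSq ε δ (ω σ) ^ r) ∂(surfaceMeasure N) :=
            lintegral_const_mul' _ _ (ENNReal.rpow_ne_top_of_nonneg hp0.le ENNReal.ofReal_ne_top)
        _ ≤ ENNReal.ofReal s ^ p * (C₂ * Y ^ p) := by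
            refine mul_le_mul_right (hE.trans ?_) _
            exact mul_le_mul_right hYint _
    refine (ENNReal.rpow_le_rpow h2 (by positivity)).trans (le_of_eq ?_)
    rw [ENNReal.mul_rpow_of_nonneg _ _ (by positivity), ENNReal.mul_rpow_of_nonneg _ _
      (by positivity), ← ENNReal.rpow_mul, ← ENNReal.rpow_mul, mul_one_div_cancel hp0.ne',
      ENNReal.rpow_one, ENNReal.rpow_one, mul_assoc]
  calc _ ≤ _ := h1
    _ ≤ C₁ * (ENNReal.ofReal s * Y + ENNReal.ofReal s * C₂ ^ (1 / p) * Y) := by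
        gcongr
        refine hWY.trans (le_mul_of_one_le_left zero_le ?_)
        rwa [ENNReal.one_le_ofReal]
    _ = _ := by ring

/-- Let `δ = 1 / (n + 1)` tend to zero by Fatou's lemma in the truncated estimate, then take `s`-th
roots. -/
theorem eLpNorm_sqrt_add_sq_le (hp : 1 < p) {χ : ℝ} (hχ : 1 < χ)
    (h : SobolevApprox p ω G φ) {C₁ C₂ : ℝ≥0}
    (hC₁ : ∀ φ : USphere N → ℝ, SphereSmooth φ →
      eLpNorm φ (ENNReal.ofReal (p * χ)) (surfaceMeasure N) ≤
        C₁ * (eLpNorm φ (ENNReal.ofReal p) (surfaceMeasure N) +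
          eLpNorm (sphereGrad φ) (ENNReal.ofReal p) (surfaceMeasure N)))
    (hC₂ : ∀ (F : ℝ → ℝ) (L : ℝ), ContDiff ℝ (⊤ : ℕ∞) F → F 0 = 0 → (∀ t, 0 ≤ deriv F t) →
        (∀ t, deriv F t ≤ L) → (∀ t, |t * F t| ≤ t ^ 2 * deriv F t) →
        ∫⁻ σ, ‖G σ‖ₑ ^ p * ENNReal.ofReal (deriv F (ω σ)) ∂(surfaceMeasure N) ≤
          C₂ * ∫⁻ σ, ‖ω σ‖ₑ ^ p * ENNReal.ofReal (deriv F (ω σ)) ∂(surfaceMeasure N))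
    {ε s : ℝ} (hε : 0 < ε) (hs : 1 ≤ s) :
    eLpNorm (fun σ => √(ε + ω σ ^ 2)) (ENNReal.ofReal (p * χ * s)) (surfaceMeasure N) ≤
      ((C₁ * (1 + C₂ ^ (1 / p)) : ℝ≥0) * ENNReal.ofReal s) ^ (1 / s) *
        eLpNorm (fun σ => √(ε + ω σ ^ 2)) (ENNReal.ofReal (p * s)) (surfaceMeasure N) := by
  have hp0 : 0 < p := by linarith
  have hs0 : 0 < s := by linarith
  have hpow : ∀ q : ℝ, 0 < q →
      eLpNorm (fun σ => (ε + ω σ ^ 2) ^ (s / 2)) (ENNReal.ofReal q) (surfaceMeasure N) =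
        eLpNorm (fun σ => √(ε + ω σ ^ 2)) (ENNReal.ofReal (q * s)) (surfaceMeasure N) ^ s := by
    intro q hq
    rw [ENNReal.ofReal_mul hq.le, ← eLpNorm_norm_rpow _ hs0]
    congr 1
    funext σ
    rw [Real.norm_of_nonneg (Real.sqrt_nonneg _), sqrt_rpow (by positivity)]
  have hlim : eLpNorm (fun σ => (ε + ω σ ^ 2) ^ (s / 2)) (ENNReal.ofReal (p * χ))
      (surfaceMeasure N) ≤ C₁ * (1 + C₂ ^ (1 / p)) * ENNReal.ofReal s *
        eLpNorm (fun σ => (ε + ω σ ^ 2) ^ (s / 2)) (ENNReal.ofReal p) (surfaceMeasure N) := by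
    have hδ : ∀ n : ℕ, (0:ℝ) < 1 / ((n:ℝ) + 1) := fun n => by positivity
    refine (Lp.eLpNorm_lim_le_liminf_eLpNorm
      (f := fun (n : ℕ) σ => truncSq ε (1 / ((n:ℝ) + 1)) (ω σ) ^ (s / 2)) (fun n => ?_) _
      (ae_of_all _ fun σ => ?_)).trans ?_
    · exact (contDiff_truncSq_rpow hε (hδ n) _).continuous.comp_aestronglyMeasurable h.memLp.1
    · exact (tendsto_truncSq ε (ω σ)).rpow_const (Or.inr (by positivity))
    · refine liminf_le_of_le (by isBoundedDefault) fun b hb => ?_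
      obtain ⟨n, hn⟩ := hb.exists
      exact hn.trans (eLpNorm_truncSq_rpow_le hp h hC₁ hC₂ hε (hδ n) hs)
  rw [hpow p hp0, hpow (p * χ) (by positivity)] at hlim
  have h3 := ENNReal.rpow_le_rpow hlim (by positivity : 0 ≤ 1 / s)
  rw [ENNReal.mul_rpow_of_nonneg _ _ (by positivity), ← ENNReal.rpow_mul, ← ENNReal.rpow_mul,
    mul_one_div_cancel hs0.ne', ENNReal.rpow_one, ENNReal.rpow_one] at h3
  rw [ENNReal.coe_mul, ENNReal.coe_add, ENNReal.coe_one,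
    ENNReal.coe_rpow_of_nonneg _ (by positivity)]
  exact h3

end MoserStep

/-! ### From the estimates to regularity of solutions. -/

section Regularity

variable {N : ℕ} {p β : ℝ} {S : Set (USphere N)} {ω : USphere N → ℝ}
  {G : USphere N → EuclideanSpace ℝ (Fin N)} {φ : ℕ → USphere N → ℝ}

theorem IsW0Solution.exists_sobolevApprox (hp : 0 < p) (hS : IsOpen S)
    (h : IsW0Solution p β S ω) :
    ∃ (G : USphere N → EuclideanSpace ℝ (Fin N)) (φ : ℕ → USphere N → ℝ),
      (∀ n, IsTestFunction S (φ n)) ∧ SobolevApprox p (S.indicator ω) G φ ∧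
        IsWeakSphereSolution p β S (S.indicator ω) G := by
  obtain ⟨G, hG, hweak⟩ := h
  obtain ⟨φ, hφ, happ⟩ := hG.exists_sobolevApprox hp hS
  refine ⟨S.indicator G, φ, hφ, happ, fun ψ hψ => ?_⟩
  have h1 := hweak ψ hψ
  rw [← integral_indicator hS.measurableSet, ← integral_indicator hS.measurableSet] at h1
  have e1 : ∀ σ, (β ^ 2 * S.indicator ω σ ^ 2 + ‖S.indicator G σ‖ ^ 2) ^ ((p - 2) / 2) *
      inner ℝ (S.indicator G σ) (sphereGrad ψ σ) =
      S.indicator (fun σ => (β ^ 2 * ω σ ^ 2 + ‖G σ‖ ^ 2) ^ ((p - 2) / 2) *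
        inner ℝ (G σ) (sphereGrad ψ σ)) σ := by
    intro σ
    by_cases hσ : σ ∈ S <;> simp [hσ]
  have e2 : ∀ σ, (β ^ 2 * S.indicator ω σ ^ 2 + ‖S.indicator G σ‖ ^ 2) ^ ((p - 2) / 2) *
      S.indicator ω σ * ψ σ =
      S.indicator (fun σ => (β ^ 2 * ω σ ^ 2 + ‖G σ‖ ^ 2) ^ ((p - 2) / 2) * ω σ * ψ σ) σ := by
    intro σ
    by_cases hσ : σ ∈ S <;> simp [hσ]
  simp only [e1, e2]
  exact h1

/-- The energy estimate with `F = id`. -/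
theorem eLpNorm_grad_le_of_energy (hp : 0 < p) {C : ℝ≥0}
    (hC : ∀ (F : ℝ → ℝ) (L : ℝ), ContDiff ℝ (⊤ : ℕ∞) F → F 0 = 0 → (∀ t, 0 ≤ deriv F t) →
        (∀ t, deriv F t ≤ L) → (∀ t, |t * F t| ≤ t ^ 2 * deriv F t) →
        ∫⁻ σ, ‖G σ‖ₑ ^ p * ENNReal.ofReal (deriv F (ω σ)) ∂(surfaceMeasure N) ≤
          C * ∫⁻ σ, ‖ω σ‖ₑ ^ p * ENNReal.ofReal (deriv F (ω σ)) ∂(surfaceMeasure N)) :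
    eLpNorm G (ENNReal.ofReal p) (surfaceMeasure N) ≤
      (C ^ (1 / p) : ℝ≥0) * eLpNorm ω (ENNReal.ofReal p) (surfaceMeasure N) := by
  have hp0 : ENNReal.ofReal p ≠ 0 := by simpa using hp
  have h := hC id 1 contDiff_id rfl (fun t => by simp) (fun t => by simp)
    (fun t => by simp [abs_mul, sq])
  simp only [deriv_id, ENNReal.ofReal_one, mul_one] at h
  rw [eLpNorm_eq_lintegral_rpow_enorm_toReal hp0 ENNReal.ofReal_ne_top,
    eLpNorm_eq_lintegral_rpow_enorm_toReal hp0 ENNReal.ofReal_ne_top,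
    ENNReal.toReal_ofReal hp.le, ENNReal.coe_rpow_of_nonneg _ (by positivity),
    ← ENNReal.mul_rpow_of_nonneg _ _ (by positivity)]
  exact ENNReal.rpow_le_rpow h (by positivity)

/-- Morrey's inequality passes to limits of smooth functions. -/
theorem SobolevApprox.exists_holder (hp : 1 ≤ p) (h : SobolevApprox p ω G φ) {C : ℝ≥0} {γ : ℝ}
    (hC : ∀ φ : USphere N → ℝ, SphereSmooth φ →
      (∀ σ : USphere N,
        ‖φ σ‖ₑ ≤ C * (eLpNorm φ (ENNReal.ofReal p) (surfaceMeasure N) +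
          eLpNorm (sphereGrad φ) (ENNReal.ofReal p) (surfaceMeasure N))) ∧
      ∀ σ τ : USphere N, edist (φ σ) (φ τ) ≤
        C * (eLpNorm φ (ENNReal.ofReal p) (surfaceMeasure N) +
          eLpNorm (sphereGrad φ) (ENNReal.ofReal p) (surfaceMeasure N)) * edist σ τ ^ γ)
    (hγ : 0 ≤ γ) :
    ∃ u : USphere N → ℝ, u =ᵐ[surfaceMeasure N] ω ∧
      (∀ σ, ‖u σ‖ₑ ≤ C * (eLpNorm ω (ENNReal.ofReal p) (surfaceMeasure N) +
        eLpNorm G (ENNReal.ofReal p) (surfaceMeasure N))) ∧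
      ∀ σ τ, edist (u σ) (u τ) ≤ C * (eLpNorm ω (ENNReal.ofReal p) (surfaceMeasure N) +
        eLpNorm G (ENNReal.ofReal p) (surfaceMeasure N)) * edist σ τ ^ γ := by
  set M := eLpNorm ω (ENNReal.ofReal p) (surfaceMeasure N) +
    eLpNorm G (ENNReal.ofReal p) (surfaceMeasure N) with hM
  have hMfin : M ≠ ∞ := ENNReal.add_ne_top.mpr ⟨h.memLp.2.ne, h.memLp_grad.2.ne⟩
  -- Limits along an ultrafilter exist at every point by boundedness, so a representative is defined
  -- everywhere and inherits both pointwise inequalities.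
  have hlim := (h.tendsto_eLpNorm hp).mono_left Nat.hyperfilter_le_atTop
  rw [← hM] at hlim
  have hCM := ENNReal.Tendsto.const_mul hlim (Or.inr (ENNReal.coe_ne_top (r := C)))
  have hCMfin : (C : ℝ≥0∞) * M ≠ ∞ := ENNReal.mul_ne_top ENNReal.coe_ne_top hMfin
  have hex : ∀ σ, ∃ y : ℝ, Tendsto (fun n => φ n σ) (hyperfilter ℕ) (𝓝 y) := by
    intro σ
    have hev := hCM.eventually (gt_mem_nhds (ENNReal.lt_add_right hCMfin one_ne_zero))
    have hmem : closedBall (0:ℝ) (C * M + 1).toReal ∈ (hyperfilter ℕ).map fun n => φ n σ := by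
      change ∀ᶠ n in (hyperfilter ℕ : Filter ℕ), φ n σ ∈ closedBall (0:ℝ) (C * M + 1).toReal
      filter_upwards [hev] with n hn
      rw [mem_closedBall_zero_iff, ← toReal_enorm]
      exact ENNReal.toReal_mono (by simp [hCMfin]) (((hC _ (h.smooth n)).1 σ).trans hn.le)
    obtain ⟨y, -, hy⟩ := (isCompact_closedBall (0:ℝ) (C * M + 1).toReal).ultrafilter_le_nhds'
      _ hmem
    exact ⟨y, hy⟩
  choose u hu using hex
  refine ⟨u, ?_, fun σ => ?_, fun σ τ => ?_⟩
  · filter_upwards [h.ae_tendsto] with σ hσ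
    exact tendsto_nhds_unique (hu σ) (hσ.mono_left Nat.hyperfilter_le_atTop)
  · exact le_of_tendsto_of_tendsto' (hu σ).enorm hCM fun n => (hC _ (h.smooth n)).1 σ
  · refine le_of_tendsto_of_tendsto' ((hu σ).edist (hu τ)) (ENNReal.Tendsto.mul_const hCM
      (Or.inr (ENNReal.rpow_ne_top_of_nonneg hγ (edist_ne_top σ τ))))
      fun n => (hC _ (h.smooth n)).2 σ τ

/-- The iteration is run on `√(ε + ω²)`, which dominates `|ω|` and exceeds it by at most `√ε`; then
`ε → 0`. -/
theorem eLpNorm_top_le_of_moser (hp : 1 < p) {χ : ℝ} (hχ : 1 < χ) (h : SobolevApprox p ω G φ)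
    {C₁ C₂ P : ℝ≥0}
    (hC₁ : ∀ φ : USphere N → ℝ, SphereSmooth φ →
      eLpNorm φ (ENNReal.ofReal (p * χ)) (surfaceMeasure N) ≤
        C₁ * (eLpNorm φ (ENNReal.ofReal p) (surfaceMeasure N) +
          eLpNorm (sphereGrad φ) (ENNReal.ofReal p) (surfaceMeasure N)))
    (hC₂ : ∀ (F : ℝ → ℝ) (L : ℝ), ContDiff ℝ (⊤ : ℕ∞) F → F 0 = 0 → (∀ t, 0 ≤ deriv F t) →
        (∀ t, deriv F t ≤ L) → (∀ t, |t * F t| ≤ t ^ 2 * deriv F t) →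
        ∫⁻ σ, ‖G σ‖ₑ ^ p * ENNReal.ofReal (deriv F (ω σ)) ∂(surfaceMeasure N) ≤
          C₂ * ∫⁻ σ, ‖ω σ‖ₑ ^ p * ENNReal.ofReal (deriv F (ω σ)) ∂(surfaceMeasure N))
    (hP : ∀ v : USphere N → ℝ, AEStronglyMeasurable v (surfaceMeasure N) →
      (∀ s : ℝ, 1 ≤ s → eLpNorm v (ENNReal.ofReal (p * χ * s)) (surfaceMeasure N) ≤
        ((C₁ * (1 + C₂ ^ (1 / p)) : ℝ≥0) * ENNReal.ofReal s) ^ (1 / s) *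
          eLpNorm v (ENNReal.ofReal (p * s)) (surfaceMeasure N)) →
      eLpNorm v ∞ (surfaceMeasure N) ≤ P * eLpNorm v (ENNReal.ofReal p) (surfaceMeasure N)) :
    eLpNorm ω ∞ (surfaceMeasure N) ≤
      P * eLpNorm ω (ENNReal.ofReal p) (surfaceMeasure N) := by
  have hp1 : (1:ℝ≥0∞) ≤ ENNReal.ofReal p := by simpa using hp.le
  have hp0 : ENNReal.ofReal p ≠ 0 := (zero_lt_one.trans_le hp1).ne'
  set m := surfaceMeasure N Set.univ ^ (1 / (ENNReal.ofReal p).toReal) with hm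
  have hmfin : m ≠ ∞ := ENNReal.rpow_ne_top_of_nonneg (by positivity) (measure_ne_top _ _)
  have hbound : ∀ ε : ℝ, 0 < ε → eLpNorm ω ∞ (surfaceMeasure N) ≤
      P * (eLpNorm ω (ENNReal.ofReal p) (surfaceMeasure N) + ENNReal.ofReal √ε * m) := by
    intro ε hε
    have hvm : AEStronglyMeasurable (fun σ => √(ε + ω σ ^ 2)) (surfaceMeasure N) :=
      Real.continuous_sqrt.comp_aestronglyMeasurable
        (aestronglyMeasurable_const.add (h.memLp.1.pow 2))
    calc eLpNorm ω ∞ (surfaceMeasure N)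
        ≤ eLpNorm (fun σ => √(ε + ω σ ^ 2)) ∞ (surfaceMeasure N) := by
          refine eLpNorm_mono fun σ => ?_
          rw [Real.norm_of_nonneg (Real.sqrt_nonneg _), Real.norm_eq_abs]
          refine Real.le_sqrt_of_sq_le ?_
          rw [sq_abs]
          linarith
      _ ≤ P * eLpNorm (fun σ => √(ε + ω σ ^ 2)) (ENNReal.ofReal p) (surfaceMeasure N) :=
          hP _ hvm fun s hs => eLpNorm_sqrt_add_sq_le hp hχ h hC₁ hC₂ hε hs
      _ ≤ P * eLpNorm ((fun σ => ‖ω σ‖) + fun _ => √ε) (ENNReal.ofReal p)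
            (surfaceMeasure N) := by
          gcongr
          refine eLpNorm_mono fun σ => ?_
          rw [Real.norm_of_nonneg (Real.sqrt_nonneg _), Pi.add_apply,
            Real.norm_of_nonneg (by positivity)]
          refine Real.sqrt_le_iff.mpr ⟨by positivity, ?_⟩
          have h1 := Real.sq_sqrt hε.le
          have h2 : ‖ω σ‖ ^ 2 = ω σ ^ 2 := by rw [Real.norm_eq_abs, sq_abs]
          have h3 : 0 ≤ ‖ω σ‖ * √ε := by positivity
          nlinarith
      _ ≤ P * (eLpNorm (fun σ => ‖ω σ‖) (ENNReal.ofReal p) (surfaceMeasure N) +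
            eLpNorm (fun _ : USphere N => √ε) (ENNReal.ofReal p) (surfaceMeasure N)) := by
          gcongr
          exact eLpNorm_add_le h.memLp.1.norm aestronglyMeasurable_const hp1
      _ = _ := by
          rw [eLpNorm_norm, eLpNorm_const' _ hp0 ENNReal.ofReal_ne_top,
            Real.enorm_of_nonneg (Real.sqrt_nonneg _)]
  have ht : Tendsto (fun n : ℕ => P * (eLpNorm ω (ENNReal.ofReal p) (surfaceMeasure N) +
      ENNReal.ofReal √(1 / ((n:ℝ) + 1)) * m)) atTop
      (𝓝 (P * (eLpNorm ω (ENNReal.ofReal p) (surfaceMeasure N) + 0))) := by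
    refine ENNReal.Tendsto.const_mul (Tendsto.const_add _ ?_) (Or.inr ENNReal.coe_ne_top)
    have h1 := ENNReal.tendsto_ofReal
      ((Real.continuous_sqrt.tendsto 0).comp tendsto_one_div_add_atTop_nhds_zero_nat)
    have h2 := ENNReal.Tendsto.mul_const h1 (Or.inr hmfin)
    simpa using h2
  rw [add_zero] at ht
  exact ge_of_tendsto' ht fun n => hbound _ (by positivity)

end Regularity

/-! ### The two ranges of `p`. -/

theorem lemma2p1 (N : ℕ) (hN : 2 ≤ N) (p β : ℝ) (hp : 1 < p) :
    ∃ c : ℝ, 0 < c ∧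
      ∀ S : Set (USphere N), IsOpen S → IsConnected S →
        ∀ ω : USphere N → ℝ, IsW0Solution p β S ω →
          ((N : ℝ) - 1 < p →
            ∃ u : USphere N → ℝ, u =ᵐ[(surfaceMeasure N).restrict S] ω ∧
              holderNormOn (1 - ((N : ℝ) - 1) / p) S u ≤
                ENNReal.ofReal c *
                  eLpNorm ω (ENNReal.ofReal p) ((surfaceMeasure N).restrict S)) ∧
          (p ≤ (N : ℝ) - 1 →
            eLpNorm ω ∞ ((surfaceMeasure N).restrict S) ≤
              ENNReal.ofReal c *
                eLpNorm ω (ENNReal.ofReal p) ((surfaceMeasure N).restrict S)) := by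
  have hp0 : 0 < p := by linarith
  obtain ⟨C₂, hC₂⟩ := exists_weighted_energy_le N hp β
  rcases lt_or_ge ((N : ℝ) - 1) p with hNp | hNp
  · obtain ⟨C, hC⟩ := exists_sphere_morrey hp hNp
    set γ := 1 - ((N : ℝ) - 1) / p with hγdef
    have hγ : 0 < γ := by
      rw [hγdef, sub_pos, div_lt_one (by linarith)]; exact hNp
    -- The `2` counts the supremum and the Hölder seminorm; `1 + C₂ ^ (1 / p)` replaces the full
    -- Sobolev norm of `ω` by its `L^p` norm.
    set K : ℝ≥0 := 2 * C * (1 + C₂ ^ (1 / p)) with hK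
    refine ⟨K + 1, by positivity, fun S hS _ ω hω => ⟨fun _ => ?_, fun h => absurd hNp h.not_gt⟩⟩
    obtain ⟨G, φ, hφ, happ, hweak⟩ := hω.exists_sobolevApprox hp0 hS
    have hG := eLpNorm_grad_le_of_energy hp0 (hC₂ S _ G φ hφ happ hweak)
    obtain ⟨u, hu, hu1, hu2⟩ := happ.exists_holder hp.le hC hγ.le
    have hSm := hS.measurableSet
    refine ⟨u, ?_, ?_⟩
    · have h1 : u =ᵐ[(surfaceMeasure N).restrict S] S.indicator ω := ae_restrict_of_ae hu
      exact h1.trans (indicator_ae_eq_restrict hSm)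
    · rw [← eLpNorm_indicator_eq_eLpNorm_restrict hSm]
      set X := eLpNorm (S.indicator ω) (ENNReal.ofReal p) (surfaceMeasure N) with hX
      set M := X + eLpNorm G (ENNReal.ofReal p) (surfaceMeasure N) with hM
      have hMX : M ≤ (1 + C₂ ^ (1 / p) : ℝ≥0) * X := by
        rw [hM, ENNReal.coe_add, ENNReal.coe_one, add_mul, one_mul]
        gcongr
      have hCM : (C : ℝ≥0∞) * M ≠ ∞ := ENNReal.mul_ne_top ENNReal.coe_ne_top
        (ENNReal.add_ne_top.mpr ⟨happ.memLp.2.ne, happ.memLp_grad.2.ne⟩)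
      have hhol : HolderWith (C * M).toNNReal γ.toNNReal (S.domRestrict u) := by
        intro x y
        rw [ENNReal.coe_toNNReal hCM, Real.coe_toNNReal _ hγ.le]
        exact hu2 x y
      have h1 : eHolderNorm γ.toNNReal (S.domRestrict u) ≤ C * M := by
        refine hhol.eHolderNorm_le.trans ?_
        rw [ENNReal.coe_toNNReal hCM]
      calc holderNormOn γ S u ≤ C * M + C * M :=
            add_le_add (iSup₂_le fun σ _ => hu1 σ) h1
        _ = 2 * C * M := by ring
        _ ≤ 2 * C * ((1 + C₂ ^ (1 / p) : ℝ≥0) * X) := by gcongr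
        _ = K * X := by rw [hK]; push_cast; ring
        _ ≤ _ := by
          gcongr
          rw [← ENNReal.ofReal_coe_nnreal]
          exact ENNReal.ofReal_le_ofReal (by linarith)
  -- The ambient Sobolev inequality requires only `p < N`, so the borderline `p = N - 1` needs no
  -- separate treatment.
  · have hpN : p < N := by linarith
    obtain ⟨C₁, hC₁⟩ := exists_sphere_sobolev hN hp.le hpN
    have hχ : 1 < (N : ℝ) / (N - p) := by
      rw [one_lt_div (by linarith)]; linarith
    obtain ⟨P, hP⟩ := exists_moser_iteration hχ (C₁ * (1 + C₂ ^ (1 / p)))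
    refine ⟨P + 1, by positivity, fun S hS _ ω hω => ⟨fun h => absurd h hNp.not_gt, fun _ => ?_⟩⟩
    obtain ⟨G, φ, hφ, happ, hweak⟩ := hω.exists_sobolevApprox hp0 hS
    have hSm := hS.measurableSet
    rw [← eLpNorm_indicator_eq_eLpNorm_restrict hSm, ← eLpNorm_indicator_eq_eLpNorm_restrict hSm]
    refine (eLpNorm_top_le_of_moser hp hχ happ hC₁ (hC₂ S _ G φ hφ happ hweak)
      fun v hv hs => hP _ v p hp0 hv hs).trans ?_
    gcongr
    rw [← ENNReal.ofReal_coe_nnreal]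
    exact ENNReal.ofReal_le_ofReal (by linarith)
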